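/- Let $\mathcal D$ be an irreducible rate matrix on a finite set $\mathsf X$, let $\mathcal U:\mathsf X\to\mathbb R$ and let $x\in\mathsf X$. For $T\ge 0$ let $p^0_T$ be the law, on the space of càdlàg paths $[0,T]\to\mathsf X$ with the $\sigma$-algebra generated by the coordinates, of the Markov process with generator $\mathcal D$ (transition semigroup $e^{t\mathcal D}$) started at $X_0=x$. For a probability measure $p$ on this path space define the $T$-stage welfare $$\mathcal W_T(p)=\mathsf E_p\Bigl[\int_0^T\mathcal U(X_t)\,dt\Bigr]-D(p\,\|\,p^0_T)\in[-\infty,\infty),$$ where $D$ is the Kullback–Leibler divergence. Let $I_{\mathcal U}=\mathrm{diag}(\mathcal U)$, and let $\Lambda$ be the largest real part of an eigenvalue of $\mathcal D+I_{\mathcal U}$. Then $\Lambda$ is itself an eigenvalue of $\mathcal D+I_{\mathcal U}$ (the Perron–Frobenius eigenvalue), and there is $v:\mathsf X\to(0,\infty)$ with $[\mathcal D+I_{\mathcal U}]v=\Lambda v$. Moreover: (i) For every $T\ge0$ the welfare $\mathcal W_T$ has a maximizer among all probability measures on the path space, and for any choice of maximizers $p^*_T$, $$\mathcal W^*_\infty:=\lim_{T\to\infty}\tfrac1T\mathcal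 W_T(p^*_T)=\Lambda .$$ Let $v:\mathsf X\to(0,\infty)$ be any solution of $[\mathcal D+I_{\mathcal U}]v=\Lambda v$, let $I_v=\mathrm{diag}(v)$, and put $$\check{\mathcal D}=I_v^{-1}[\mathcal D+I_{\mathcal U}-\Lambda I]I_v .$$ (ii) $\check{\mathcal D}$ is a rate matrix; for every $T\ge0$ there is exactly one law $\check p_T$ on the path space of the time-homogeneous Markov process with generator $\check{\mathcal D}$ started at $X_0=x$; and these laws attain the optimal average welfare: $\lim_{T\to\infty}\frac1T\mathcal W_T(\check p_T)=\Lambda=\mathcal W^*_\infty$. (iii) For every $T\ge 0$, $$\mathcal W_T(\check p_T)=T\Lambda-\mathsf E_{\check p_T}\Bigl[\log\frac{v(X_T)}{v(X_0)}\Bigr].$$ -/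

import Mathlib

open MeasureTheory Filter Topology
open scoped NNReal ENNReal Matrix

noncomputable section

/-- A rate matrix: the generator of a continuous-time Markov process on the finite set `S`. -/
structure IsRateMatrix {S : Type*} [Fintype S] (D : Matrix S S ℝ) : Prop where
  off_diag_nonneg : ∀ x y, x ≠ y → 0 ≤ D x y
  row_sum : ∀ x, ∑ y, D x y = 0

/-- Irreducibility: every state can be reached from every state along transitions
of positive rate. (The diagonal of a rate matrix is nonpositive, so only genuine jumps count.) -/
def IsIrreducibleRate {S : Type*} (D : Matrix S S ℝ) : Prop :=
  ∀ x y, Relation.ReflTransGen (fun a b => 0 < D a b) x y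

/-- The largest real part of a complex eigenvalue of the real matrix `M`. -/
def maxRealPart {S : Type*} [Fintype S] [DecidableEq S] (M : Matrix S S ℝ) : ℝ :=
  sSup (Complex.re '' spectrum ℂ (M.map (algebraMap ℝ ℂ)))

/-- Sample paths on `[0, T]` with values in the discrete set `S` that are right continuous and
have left limits. -/
structure CadlagPath (S : Type*) (T : ℝ≥0) where
  toFun : Set.Icc (0 : ℝ) T → S
  right_cont : ∀ t, ∀ᶠ s in 𝓝[≥] t, toFun s = toFun t
  left_lim : ∀ t, ∃ a, ∀ᶠ s in 𝓝[<] t, toFun s = a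

instance CadlagPath.instCoeFun {S : Type*} {T : ℝ≥0} :
    CoeFun (CadlagPath S T) (fun _ => Set.Icc (0 : ℝ) T → S) :=
  ⟨CadlagPath.toFun⟩

/-- The sigma-algebra generated by the process `X_t(ω) = ω t`, `0 ≤ t ≤ T`
(all subsets of `S` are measurable). -/
instance CadlagPath.instMeasurableSpace {S : Type*} {T : ℝ≥0} :
    MeasurableSpace (CadlagPath S T) :=
  ⨆ t : Set.Icc (0 : ℝ) T, MeasurableSpace.comap (fun ω : CadlagPath S T => ω t) ⊤

/-- The initial time, as a point of `[0, T]`. -/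
def startTime (T : ℝ≥0) : Set.Icc (0 : ℝ) T := ⟨0, le_rfl, T.coe_nonneg⟩

/-- The terminal time, as a point of `[0, T]`. -/
def endTime (T : ℝ≥0) : Set.Icc (0 : ℝ) T := ⟨T, T.coe_nonneg, le_rfl⟩

/-- `p` is the distribution on `[0, T]` of the time-homogeneous Markov process with generator `D`
(transition semigroup `P^t = exp (t D)`) and initial condition `X_0 = x`: for all
`0 = t_0 ≤ t_1 ≤ ⋯ ≤ t_n ≤ T` and all states `y_0, …, y_n`,
`p (X_{t_0} = y_0, …, X_{t_n} = y_n) = 1{y_0 = x} ∏_{i<n} P^{t_{i+1} - t_i} (y_i, y_{i+1})`. -/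
def IsMarkovLaw {S : Type*} [Fintype S] [DecidableEq S] (D : Matrix S S ℝ) (x : S) (T : ℝ≥0)
    (p : Measure (CadlagPath S T)) : Prop :=
  ∀ (n : ℕ) (t : Fin (n + 1) → Set.Icc (0 : ℝ) T) (y : Fin (n + 1) → S),
    Monotone t → t 0 = startTime T →
      p {ω | ∀ i, ω (t i) = y i} =
        ENNReal.ofReal ((if y 0 = x then 1 else 0) *
          ∏ i : Fin n, NormedSpace.exp (((t i.succ : ℝ) - (t i.castSucc : ℝ)) • D)
            (y i.castSucc) (y i.succ))

/-- The `T`-stage welfare `E_p[∫_0^T U(X_t) dt] - D(p ‖ p0)`, an extended real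
(it is `-∞` exactly when the divergence is infinite). The map `Set.projIcc` only regards
`t ∈ [0, T]` as a point of the index set of the path. -/
def welfare {S : Type*} {T : ℝ≥0} (U : S → ℝ) (p0 p : Measure (CadlagPath S T)) : EReal :=
  ((∫ ω, (∫ t in (0 : ℝ)..T, U (ω (Set.projIcc 0 (T : ℝ) T.coe_nonneg t))) ∂p : ℝ) : EReal) -
    ((InformationTheory.klDiv p p0 : ℝ≥0∞) : EReal)

/-- `p` maximizes the `T`-stage welfare among all probability measures on path space. -/
def IsWelfareOptimal {S : Type*} {T : ℝ≥0} (U : S → ℝ) (p0 p : Measure (CadlagPath S T)) : Prop :=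
  IsProbabilityMeasure p ∧
    ∀ q : Measure (CadlagPath S T), IsProbabilityMeasure q → welfare U p0 q ≤ welfare U p0 p

/-- `w` is the limit of `W_T / T` as `T → ∞`, where `W_T = welfare U (p0 T) (p T)`. -/
def HasAverageWelfare {S : Type*} (U : S → ℝ) (p0 p : ∀ T : ℝ≥0, Measure (CadlagPath S T))
    (w : ℝ) : Prop :=
  Tendsto (fun T : ℝ≥0 => welfare U (p0 T) (p T) / ((T : ℝ) : EReal)) atTop (𝓝 (w : EReal))

/-- The matrix `I_v⁻¹ [D + I_U - Λ I] I_v`. -/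
def twistedGenerator {S : Type*} [Fintype S] [DecidableEq S] (D : Matrix S S ℝ) (U : S → ℝ)
    (Λ : ℝ) (v : S → ℝ) : Matrix S S ℝ :=
  (Matrix.diagonal v)⁻¹ * (D + Matrix.diagonal U - Λ • (1 : Matrix S S ℝ)) * Matrix.diagonal v

end

/-!
By Perron–Frobenius, `D + diag U` has a positive eigenvector `v` for the eigenvalue `Λ` of largest
real part. Write `R = ∫_0^T U(X_t) dt`. The Gibbs variational principle
`E_q[f] - KL(q ‖ p) = log E_p[e^f] - KL(q ‖ p.tilted f)` with `f = R` shows that tilting `p` by `R`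
maximizes the welfare. Applied instead to
`f = R - T Λ + log (v(X_T) / v(X_0))`, it gives, for every law `q`,
`W_T(q) = T Λ - E_q[log (v(X_T) / v(X_0))] - KL(q ‖ p.tilted f)`,
because `E_p[e^f] = 1` by the Feynman–Kac formula. The logarithm is bounded uniformly in `T`, so
optimal welfare grows at rate `Λ`; and the Feynman–Kac formula on cylinder sets identifies
`p.tilted f` with the law of the Markov process generated by the twisted matrix.
-/

/-- Metzler matrices are the matrices with nonnegative off-diagonal entries; their exponentials are
nonnegative and Perron–Frobenius theory applies to them. -/
def IsMetzler {S : Type*} (A : Matrix S S ℝ) : Prop :=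
  ∀ i j, i ≠ j → 0 ≤ A i j

lemma IsRateMatrix.isMetzler {S : Type*} [Fintype S] {D : Matrix S S ℝ} (hD : IsRateMatrix D) :
    IsMetzler D :=
  hD.off_diag_nonneg

lemma IsMetzler.smul {S : Type*} {A : Matrix S S ℝ} (hA : IsMetzler A) {c : ℝ} (hc : 0 ≤ c) :
    IsMetzler (c • A) :=
  fun i j hij => mul_nonneg hc (hA i j hij)

section MatrixExponential

variable {S : Type*} [Fintype S] [DecidableEq S] {A : Matrix S S ℝ}

lemma exp_smul_one_matrix (c : ℝ) :
    NormedSpace.exp (c • (1 : Matrix S S ℝ)) = Real.exp c • (1 : Matrix S S ℝ) := by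
  rw [Matrix.smul_one_eq_diagonal, Matrix.exp_diagonal, Matrix.smul_one_eq_diagonal]
  congr 1
  ext i
  rw [Pi.coe_exp, Real.exp_eq_exp_ℝ]

lemma exp_add_smul_one (A : Matrix S S ℝ) (c : ℝ) :
    NormedSpace.exp (A + c • (1 : Matrix S S ℝ)) = Real.exp c • NormedSpace.exp A := by
  rw [Matrix.exp_add_of_commute _ _ ((Commute.one_right A).smul_right c), exp_smul_one_matrix,
    mul_smul_comm, mul_one]

open scoped Matrix.Norms.Operator in
lemma hasSum_exp_matrix (A : Matrix S S ℝ) :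
    HasSum (fun n : ℕ => (n.factorial : ℝ)⁻¹ • A ^ n) (NormedSpace.exp A) :=
  NormedSpace.exp_series_hasSum_exp' (𝕂 := ℝ) A

lemma hasSum_exp_matrix_apply (A : Matrix S S ℝ) (i j : S) :
    HasSum (fun n : ℕ => (n.factorial : ℝ)⁻¹ * (A ^ n) i j) (NormedSpace.exp A i j) :=
  Pi.hasSum.mp (Pi.hasSum.mp (hasSum_exp_matrix A) i) j

lemma pow_mulVec_of_eigenvector {r : ℝ} {v : S → ℝ} (h : A *ᵥ v = r • v) (n : ℕ) :
    (A ^ n) *ᵥ v = r ^ n • v := by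
  induction n with
  | zero => simp
  | succ n ih =>
    rw [pow_succ, ← Matrix.mulVec_mulVec, h, Matrix.mulVec_smul, ih, smul_smul, pow_succ', mul_comm]

lemma exp_mulVec_of_eigenvector {r : ℝ} {v : S → ℝ} (h : A *ᵥ v = r • v) :
    NormedSpace.exp A *ᵥ v = Real.exp r • v := by
  have hA : HasSum (fun n : ℕ => ((n.factorial : ℝ)⁻¹ • A ^ n) *ᵥ v) (NormedSpace.exp A *ᵥ v) :=
    (hasSum_exp_matrix A).map (⟨⟨fun B : Matrix S S ℝ => B *ᵥ v, Matrix.zero_mulVec v⟩,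
      fun B C => Matrix.add_mulVec B C v⟩ : Matrix S S ℝ →+ (S → ℝ))
      (continuous_id.matrix_mulVec continuous_const)
  have hr : HasSum (fun n : ℕ => ((n.factorial : ℝ)⁻¹ • r ^ n) • v) (Real.exp r • v) := by
    rw [Real.exp_eq_exp_ℝ]
    exact (NormedSpace.exp_series_hasSum_exp' (𝕂 := ℝ) r).smul_const v
  refine hA.unique (hr.congr_fun fun n => ?_)
  rw [Matrix.smul_mulVec, pow_mulVec_of_eigenvector h, smul_assoc]

end MatrixExponential

section PerronFrobenius

variable {S : Type*} {A : Matrix S S ℝ}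

lemma IsMetzler.add_diagonal [DecidableEq S] (hA : IsMetzler A) (u : S → ℝ) :
    IsMetzler (A + Matrix.diagonal u) := by
  intro i j hij
  simpa [hij] using hA i j hij

lemma IsIrreducibleRate.add_diagonal [DecidableEq S] (hA : IsIrreducibleRate A) (u : S → ℝ) :
    IsIrreducibleRate (A + Matrix.diagonal u) := by
  intro i j
  refine Relation.reflTransGen_closed (fun a b hab => ?_) i j (hA i j)
  rcases eq_or_ne a b with rfl | hne
  · exact .refl
  · exact .single (by simpa [hne] using hab)

lemma IsMetzler.exists_add_smul_one_nonneg [Finite S] [DecidableEq S] (hA : IsMetzler A) :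
    ∃ c : ℝ, ∀ i j, 0 ≤ (A + c • (1 : Matrix S S ℝ)) i j := by
  obtain ⟨c, hc⟩ := (Set.finite_range fun i => -A i i).bddAbove
  refine ⟨c, fun i j => ?_⟩
  rcases eq_or_ne i j with rfl | hij
  · have : -A i i ≤ c := hc ⟨i, rfl⟩
    simp only [Matrix.add_apply, Matrix.smul_apply, Matrix.one_apply_eq, smul_eq_mul, mul_one]
    linarith
  · simpa [hij] using hA i j hij

variable [Fintype S]

lemma exists_pow_apply_pos [DecidableEq S] (hA : ∀ i j, 0 ≤ A i j) {i j : S}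
    (h : Relation.ReflTransGen (fun a b => 0 < A a b) i j) : ∃ n : ℕ, 0 < (A ^ n) i j := by
  induction h with
  | refl => exact ⟨0, by simp⟩
  | @tail b c _ hbc ih =>
    obtain ⟨n, hn⟩ := ih
    refine ⟨n + 1, ?_⟩
    rw [pow_succ, Matrix.mul_apply]
    exact Finset.sum_pos' (fun l _ => mul_nonneg (Matrix.pow_apply_nonneg hA n i l) (hA l c))
      ⟨b, Finset.mem_univ b, mul_pos hn hbc⟩

lemma IsMetzler.exp_apply_nonneg [DecidableEq S] (hA : IsMetzler A) (i j : S) :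
    0 ≤ NormedSpace.exp A i j := by
  obtain ⟨c, hc⟩ := hA.exists_add_smul_one_nonneg
  have h : 0 ≤ NormedSpace.exp (A + c • (1 : Matrix S S ℝ)) i j :=
    (hasSum_exp_matrix_apply _ i j).nonneg fun n =>
      mul_nonneg (by positivity) (Matrix.pow_apply_nonneg hc n i j)
  rw [exp_add_smul_one] at h
  exact nonneg_of_mul_nonneg_right h (Real.exp_pos c)

lemma IsMetzler.exp_apply_pos [DecidableEq S] (hA : IsMetzler A) (hirr : IsIrreducibleRate A)
    (i j : S) : 0 < NormedSpace.exp A i j := by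
  obtain ⟨c, hc⟩ := hA.exists_add_smul_one_nonneg
  have hirr' : IsIrreducibleRate (A + c • (1 : Matrix S S ℝ)) := by
    rw [Matrix.smul_one_eq_diagonal]
    exact hirr.add_diagonal _
  obtain ⟨n, hn⟩ := exists_pow_apply_pos hc (hirr' i j)
  have h : 0 < NormedSpace.exp (A + c • (1 : Matrix S S ℝ)) i j :=
    (mul_pos (by positivity) hn).trans_le <| le_hasSum (hasSum_exp_matrix_apply _ i j) n
      fun k _ => mul_nonneg (by positivity) (Matrix.pow_apply_nonneg hc k i j)
  rw [exp_add_smul_one] at h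
  exact pos_of_mul_pos_right h (Real.exp_pos c).le

lemma mulVec_pos_of_pos {P : Matrix S S ℝ} (hP : ∀ i j, 0 < P i j) {u : S → ℝ}
    (hu : 0 ≤ u) (hu0 : u ≠ 0) (i : S) : 0 < (P *ᵥ u) i := by
  obtain ⟨j, hj⟩ := Function.ne_iff.mp hu0
  exact Finset.sum_pos' (fun l _ => mul_nonneg (hP i l).le (hu l))
    ⟨j, Finset.mem_univ j, mul_pos (hP i j) ((hu j).lt_of_ne (Ne.symm hj))⟩

/-- The Collatz–Wielandt quotient of a positive vector `u`: the largest `r` with `r • u ≤ A *ᵥ u`.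
Its maximum over `u` is the Perron–Frobenius eigenvalue of `A`. -/
noncomputable def collatzWielandt (A : Matrix S S ℝ) (u : S → ℝ) : ℝ :=
  ⨅ i, (A *ᵥ u) i / u i

lemma collatzWielandt_smul (A : Matrix S S ℝ) (u : S → ℝ) {c : ℝ} (hc : c ≠ 0) :
    collatzWielandt A (c • u) = collatzWielandt A u := by
  simp only [collatzWielandt, Matrix.mulVec_smul, Pi.smul_apply, smul_eq_mul,
    mul_div_mul_left _ _ hc]

lemma collatzWielandt_smul_le {u : S → ℝ} (hu : ∀ i, 0 < u i) :
    collatzWielandt A u • u ≤ A *ᵥ u :=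
  fun i => (le_div_iff₀ (hu i)).mp (ciInf_le (Set.finite_range _).bddBelow i)

lemma lt_collatzWielandt [Nonempty S] {u : S → ℝ} (hu : ∀ i, 0 < u i) {r : ℝ}
    (h : ∀ i, r * u i < (A *ᵥ u) i) : r < collatzWielandt A u := by
  obtain ⟨i, hi⟩ := exists_eq_ciInf_of_finite (f := fun i => (A *ᵥ u) i / u i)
  rw [collatzWielandt, ← hi]
  exact (lt_div_iff₀ (hu i)).mpr (h i)

lemma continuousOn_collatzWielandt [Nonempty S] {X : Type*} [TopologicalSpace X] {K : Set X}
    {u : X → S → ℝ} (hu : ContinuousOn u K) (hpos : ∀ w ∈ K, ∀ i, 0 < u w i) :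
    ContinuousOn (fun w => collatzWielandt A (u w)) K := by
  simp only [collatzWielandt, ← Finset.inf'_univ_eq_ciInf]
  refine ContinuousOn.finset_inf'_apply _ fun i _ =>
    ContinuousOn.div ?_ (continuousOn_pi.mp hu i) fun w hw => (hpos w hw i).ne'
  exact continuousOn_pi.mp ((continuous_const.matrix_mulVec continuous_id).comp_continuousOn hu) i

/-- Maximising the Collatz–Wielandt quotient over the image of the simplex under the positive
matrix `exp A` keeps the maximiser positive; were it not an eigenvector, applying `exp A`, which
commutes with `A`, once more would increase the quotient. -/
theorem IsMetzler.exists_pos_eigenvector [Nonempty S] (hA : IsMetzler A)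
    (hirr : IsIrreducibleRate A) :
    ∃ (r : ℝ) (v : S → ℝ), (∀ i, 0 < v i) ∧ A *ᵥ v = r • v := by
  classical
  set P := NormedSpace.exp A
  have hP : ∀ i j, 0 < P i j := hA.exp_apply_pos hirr
  have hPA (u : S → ℝ) : P *ᵥ (A *ᵥ u) = A *ᵥ (P *ᵥ u) := by
    rw [Matrix.mulVec_mulVec, Matrix.mulVec_mulVec, (Commute.refl A).exp_left.eq]
  have hpos : ∀ w ∈ stdSimplex ℝ S, ∀ i, 0 < (P *ᵥ w) i := by
    rintro w ⟨hw, hsum⟩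
    exact mulVec_pos_of_pos hP hw (by rintro rfl; simp at hsum)
  obtain ⟨w, hw, hmax⟩ := (isCompact_stdSimplex ℝ S).exists_isMaxOn
    ⟨_, single_mem_stdSimplex ℝ (Classical.arbitrary S)⟩
    (continuousOn_collatzWielandt (A := A) (u := fun w => P *ᵥ w)
      (continuous_const.matrix_mulVec continuous_id).continuousOn hpos)
  set u := P *ᵥ w
  set r := collatzWielandt A u
  have hu : ∀ i, 0 < u i := hpos w hw
  refine ⟨r, u, hu, ?_⟩
  by_contra hne
  have hPu : ∀ i, 0 < (P *ᵥ u) i :=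
    mulVec_pos_of_pos hP (fun i => (hu i).le) fun h =>
      (hu (Classical.arbitrary S)).ne' (congrFun h _)
  have hlt : r < collatzWielandt A (P *ᵥ u) := by
    refine lt_collatzWielandt hPu fun i => ?_
    have h := mulVec_pos_of_pos hP (sub_nonneg.mpr (collatzWielandt_smul_le hu))
      (sub_ne_zero.mpr hne) i
    rwa [Matrix.mulVec_sub, Matrix.mulVec_smul, hPA, Pi.sub_apply, sub_pos] at h
  set c := ∑ i, u i
  have hc : 0 < c := Finset.sum_pos (fun i _ => hu i) Finset.univ_nonempty
  have hmem : c⁻¹ • u ∈ stdSimplex ℝ S :=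
    ⟨fun i => mul_nonneg (inv_nonneg.mpr hc.le) (hu i).le, by
      simp only [Pi.smul_apply, smul_eq_mul, ← Finset.mul_sum]
      exact inv_mul_cancel₀ hc.ne'⟩
  have hle : collatzWielandt A (P *ᵥ (c⁻¹ • u)) ≤ r := hmax hmem
  rw [Matrix.mulVec_smul, collatzWielandt_smul _ _ (inv_ne_zero hc.ne')] at hle
  exact hle.not_gt hlt

variable {r : ℝ} {v : S → ℝ}

lemma mem_spectrum_map_of_eigenvector [DecidableEq S] (hv : v ≠ 0) (hAv : A *ᵥ v = r • v) :
    (r : ℂ) ∈ spectrum ℂ (A.map (algebraMap ℝ ℂ)) := by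
  rw [← Matrix.spectrum_toLin', ← Module.End.hasEigenvalue_iff_mem_spectrum]
  refine Module.End.hasEigenvalue_of_hasEigenvector (x := fun i => (v i : ℂ)) ⟨?_, fun h => ?_⟩
  · rw [Module.End.mem_eigenspace_iff, Matrix.toLin'_apply]
    ext i
    simpa [Matrix.mulVec, dotProduct] using congrArg Complex.ofReal (congrFun hAv i)
  · exact hv (funext fun i => by simpa using congrFun h i)

/-- Gershgorin's theorem for `A` conjugated by the diagonal matrix with entries `v`. -/
lemma eigenvalue_mem_weighted_ball {K : Type*} [NormedField K] [DecidableEq S] {A : Matrix S S K}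
    {v : S → K} (hv : ∀ i, v i ≠ 0) {μ : K} (hμ : Module.End.HasEigenvalue (Matrix.toLin' A) μ) :
    ∃ k, μ ∈ Metric.closedBall (A k k) (∑ j ∈ Finset.univ.erase k, ‖(v k)⁻¹ * (A k j * v j)‖) := by
  obtain ⟨w, hw⟩ := hμ.exists_hasEigenvector
  set B : Matrix S S K := .of fun i j => (v i)⁻¹ * (A i j * v j) with hB
  have hBμ : Module.End.HasEigenvalue (Matrix.toLin' B) μ := by
    refine Module.End.hasEigenvalue_of_hasEigenvector (x := fun i => w i / v i) ⟨?_, fun h => ?_⟩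
    · rw [Module.End.mem_eigenspace_iff, Matrix.toLin'_apply]
      ext i
      calc ∑ j, B i j * (w j / v j) = (v i)⁻¹ * (A *ᵥ w) i := by
            rw [Matrix.mulVec, dotProduct, Finset.mul_sum]
            refine Finset.sum_congr rfl fun j _ => ?_
            rw [hB, Matrix.of_apply]
            field_simp [hv j]
        _ = μ * (w i / v i) := by
            rw [show A *ᵥ w = μ • w from hw.apply_eq_smul, Pi.smul_apply, smul_eq_mul]
            ring
    · exact hw.2 (funext fun i => by simpa [hv i] using congrFun h i)
  obtain ⟨k, hk⟩ := eigenvalue_mem_ball hBμ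
  have hkk : B k k = A k k := by
    rw [hB, Matrix.of_apply, mul_comm, mul_assoc, mul_inv_cancel₀ (hv k), mul_one]
  exact ⟨k, hkk ▸ hk⟩

lemma IsMetzler.re_le_of_pos_eigenvector [DecidableEq S] (hA : IsMetzler A) (hv : ∀ i, 0 < v i)
    (hAv : A *ᵥ v = r • v) {μ : ℂ} (hμ : μ ∈ spectrum ℂ (A.map (algebraMap ℝ ℂ))) :
    μ.re ≤ r := by
  rw [← Matrix.spectrum_toLin', ← Module.End.hasEigenvalue_iff_mem_spectrum] at hμ
  obtain ⟨k, hk⟩ := eigenvalue_mem_weighted_ball (v := fun i => (v i : ℂ))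
    (fun i => Complex.ofReal_ne_zero.mpr (hv i).ne') hμ
  have hradius : ∑ j ∈ Finset.univ.erase k,
      ‖(v k : ℂ)⁻¹ * (A.map (algebraMap ℝ ℂ) k j * v j)‖ = r - A k k := by
    calc ∑ j ∈ Finset.univ.erase k, ‖(v k : ℂ)⁻¹ * (A.map (algebraMap ℝ ℂ) k j * v j)‖
        = ∑ j ∈ Finset.univ.erase k, (v k)⁻¹ * (A k j * v j) := by
          refine Finset.sum_congr rfl fun j hj => ?_
          rw [norm_mul, norm_mul, norm_inv, Matrix.map_apply, Complex.coe_algebraMap,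
            Complex.norm_of_nonneg (hv k).le, Complex.norm_of_nonneg (hv j).le,
            Complex.norm_of_nonneg (hA k j (Finset.ne_of_mem_erase hj).symm)]
      _ = (v k)⁻¹ * ((A *ᵥ v) k - A k k * v k) := by
          rw [← Finset.mul_sum, Finset.sum_erase_eq_sub (Finset.mem_univ k)]
          rfl
      _ = r - A k k := by
          rw [hAv, Pi.smul_apply, smul_eq_mul]
          field_simp [(hv k).ne']
  rw [mem_closedBall_iff_norm, hradius] at hk
  have := (Complex.re_le_norm _).trans hk
  rw [Complex.sub_re, Matrix.map_apply, Complex.coe_algebraMap, Complex.ofReal_re] at this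
  linarith

lemma IsMetzler.maxRealPart_eq_of_pos_eigenvector [DecidableEq S] [Nonempty S] (hA : IsMetzler A)
    (hv : ∀ i, 0 < v i) (hAv : A *ᵥ v = r • v) : maxRealPart A = r := by
  have hv0 : v ≠ 0 := fun h => (hv (Classical.arbitrary S)).ne' (congrFun h _)
  refine IsGreatest.csSup_eq ⟨⟨r, mem_spectrum_map_of_eigenvector hv0 hAv, Complex.ofReal_re r⟩, ?_⟩
  rintro _ ⟨μ, hμ, rfl⟩
  exact hA.re_le_of_pos_eigenvector hv hAv hμ

end PerronFrobenius

section MatrixSemigroup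

variable {S : Type*} [Fintype S] [DecidableEq S]

open scoped Matrix.Norms.Operator in
lemma hasDerivAt_exp_smul_matrix_apply (A : Matrix S S ℝ) (t : ℝ) (i j : S) :
    HasDerivAt (fun r : ℝ => NormedSpace.exp (r • A) i j) ((A * NormedSpace.exp (t • A)) i j) t :=
  (Matrix.entryLinearMap ℝ ℝ i j).toContinuousLinearMap.hasFDerivAt.comp_hasDerivAt t
    (hasDerivAt_exp_smul_const' A t)

lemma continuous_exp_smul_mulVec (A : Matrix S S ℝ) (f : S → ℝ) :
    Continuous fun t : ℝ => NormedSpace.exp (t • A) *ᵥ f := by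
  refine Continuous.matrix_mulVec (continuous_matrix fun i j => ?_) continuous_const
  exact continuous_iff_continuousAt.mpr fun t =>
    (hasDerivAt_exp_smul_matrix_apply A t i j).continuousAt

lemma hasDerivAt_exp_smul_mulVec (A : Matrix S S ℝ) (f : S → ℝ) :
    HasDerivAt (fun t : ℝ => NormedSpace.exp (t • A) *ᵥ f) (A *ᵥ f) 0 := by
  refine hasDerivAt_pi.mpr fun i => ?_
  have h := HasDerivAt.fun_sum (u := Finset.univ) fun j _ =>
    (hasDerivAt_exp_smul_matrix_apply A 0 i j).mul_const (f j)
  simp only [zero_smul, NormedSpace.exp_zero, mul_one] at h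
  exact h

/-- The integrating factor `exp ((b - r) • A)` makes `f r ᵥ* exp ((b - r) • A)` constant. -/
lemma eq_vecMul_exp_of_hasDerivWithinAt {A : Matrix S S ℝ} {f : ℝ → S → ℝ} {a b : ℝ} (hab : a ≤ b)
    (hf : ContinuousOn f (Set.Icc a b))
    (hf' : ∀ r ∈ Set.Ico a b, HasDerivWithinAt f (f r ᵥ* A) (Set.Ici r) r) :
    f b = f a ᵥ* NormedSpace.exp ((b - a) • A) := by
  set E : ℝ → Matrix S S ℝ := fun r => NormedSpace.exp ((b - r) • A)
  have hE (r : ℝ) (i j : S) : HasDerivAt (fun r => E r i j) (-(A * E r) i j) r := by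
    simpa using (hasDerivAt_exp_smul_matrix_apply A (b - r) i j).comp_const_sub b r
  have hEcont : Continuous E :=
    continuous_matrix fun i j => continuous_iff_continuousAt.mpr fun r => (hE r i j).continuousAt
  have hderiv : ∀ r ∈ Set.Ico a b, HasDerivWithinAt (fun r => f r ᵥ* E r) 0 (Set.Ici r) r := by
    refine fun r hr => hasDerivWithinAt_pi.mpr fun j => ?_
    have h := HasDerivWithinAt.fun_sum (u := Finset.univ) fun i _ =>
      (hasDerivWithinAt_pi.mp (hf' r hr) i).fun_mul (hE r i j).hasDerivWithinAt
    have hzero : ∑ i, ((f r ᵥ* A) i * E r i j + f r i * -(A * E r) i j) = 0 := by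
      calc ∑ i, ((f r ᵥ* A) i * E r i j + f r i * -(A * E r) i j)
          = ((f r ᵥ* A) ᵥ* E r - f r ᵥ* (A * E r)) j := by
            simp only [mul_neg, ← sub_eq_add_neg, Finset.sum_sub_distrib]
            rfl
        _ = 0 := by rw [Matrix.vecMul_vecMul, sub_self, Pi.zero_apply]
    rwa [hzero] at h
  have hcont : ContinuousOn (fun r => f r ᵥ* E r) (Set.Icc a b) :=
    (continuous_fst.matrix_vecMul continuous_snd).comp_continuousOn (hf.prodMk hEcont.continuousOn)
  have h := constant_of_has_deriv_right_zero hcont hderiv b (Set.right_mem_Icc.mpr hab)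
  simpa [E] using h

lemma IsRateMatrix.exp_smul_mulVec_one {D : Matrix S S ℝ} (hD : IsRateMatrix D) (t : ℝ) :
    NormedSpace.exp (t • D) *ᵥ 1 = 1 := by
  have h : (t • D) *ᵥ (1 : S → ℝ) = (0 : ℝ) • 1 := by
    ext i
    simp [Matrix.mulVec, dotProduct, ← Finset.mul_sum, hD.row_sum]
  simpa using exp_mulVec_of_eigenvector h

end MatrixSemigroup

section TwistedGenerator

variable {S : Type*} [Fintype S] [DecidableEq S] {D : Matrix S S ℝ} {U : S → ℝ} {Λ : ℝ} {v : S → ℝ}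

lemma inv_diagonal_of_pos (hv : ∀ y, 0 < v y) : (Matrix.diagonal v)⁻¹ = Matrix.diagonal v⁻¹ := by
  refine Matrix.inv_eq_right_inv ?_
  rw [Matrix.diagonal_mul_diagonal, ← Matrix.diagonal_one]
  congr 1
  ext y
  exact mul_inv_cancel₀ (hv y).ne'

lemma twistedGenerator_apply (hv : ∀ y, 0 < v y) (i j : S) : twistedGenerator D U Λ v i j =
    (v i)⁻¹ * (D + Matrix.diagonal U - Λ • (1 : Matrix S S ℝ)) i j * v j := by
  rw [twistedGenerator, Matrix.mul_diagonal, inv_diagonal_of_pos hv, Matrix.diagonal_mul,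
    Pi.inv_apply]

lemma isRateMatrix_twistedGenerator (hD : IsMetzler D) (hv : ∀ y, 0 < v y)
    (hDv : (D + Matrix.diagonal U) *ᵥ v = Λ • v) : IsRateMatrix (twistedGenerator D U Λ v) where
  off_diag_nonneg i j hij := by
    rw [twistedGenerator_apply hv]
    refine mul_nonneg (mul_nonneg (inv_nonneg.mpr (hv i).le) ?_) (hv j).le
    simpa [hij] using hD i j hij
  row_sum i := by
    have h : (D + Matrix.diagonal U - Λ • (1 : Matrix S S ℝ)) *ᵥ v = 0 := by
      rw [Matrix.sub_mulVec, hDv, Matrix.smul_mulVec, Matrix.one_mulVec, sub_self]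
    calc ∑ j, twistedGenerator D U Λ v i j
        = (v i)⁻¹ * ((D + Matrix.diagonal U - Λ • (1 : Matrix S S ℝ)) *ᵥ v) i := by
          simp only [twistedGenerator_apply hv, mul_assoc, ← Finset.mul_sum]
          rfl
      _ = 0 := by rw [h, Pi.zero_apply, mul_zero]

lemma exp_smul_twistedGenerator (hv : ∀ y, 0 < v y) (t : ℝ) :
    NormedSpace.exp (t • twistedGenerator D U Λ v) =
      Real.exp (-(t * Λ)) • ((Matrix.diagonal v)⁻¹ *
        NormedSpace.exp (t • (D + Matrix.diagonal U)) * Matrix.diagonal v) := by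
  have hunit : IsUnit (Matrix.diagonal v) := by
    rw [Matrix.isUnit_diagonal, Pi.isUnit_iff]
    exact fun y => (hv y).ne'.isUnit
  have h : t • twistedGenerator D U Λ v = (Matrix.diagonal v)⁻¹ *
      (t • (D + Matrix.diagonal U) + (-(t * Λ)) • (1 : Matrix S S ℝ)) * Matrix.diagonal v := by
    rw [twistedGenerator, ← Matrix.smul_mul, ← Matrix.mul_smul, smul_sub, smul_smul, neg_smul,
      sub_eq_add_neg]
  rw [h, Matrix.exp_conj' _ _ hunit, exp_add_smul_one, mul_smul_comm, smul_mul_assoc]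

lemma exp_smul_mulVec_mul (hv : ∀ y, 0 < v y) (t : ℝ) (f : S → ℝ) :
    NormedSpace.exp (t • (D + Matrix.diagonal U)) *ᵥ (v * f) =
      Real.exp (t * Λ) • (v * NormedSpace.exp (t • twistedGenerator D U Λ v) *ᵥ f) := by
  ext i
  rw [exp_smul_twistedGenerator hv, Matrix.smul_mulVec, ← Matrix.mulVec_mulVec,
    ← Matrix.mulVec_mulVec, inv_diagonal_of_pos hv, Pi.smul_apply, Pi.mul_apply, Pi.smul_apply,
    Matrix.mulVec_diagonal, Pi.inv_apply, smul_eq_mul, smul_eq_mul, mul_left_comm (v i),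
    mul_inv_cancel_left₀ (hv i).ne', ← mul_assoc, ← Real.exp_add, add_neg_cancel, Real.exp_zero,
    one_mul]
  congr 2
  ext j
  rw [Matrix.mulVec_diagonal, Pi.mul_apply]

end TwistedGenerator

section GibbsVariationalPrinciple

open InformationTheory

variable {Ω : Type*} [MeasurableSpace Ω] {p q : Measure Ω} {f : Ω → ℝ}

lemma klDiv_tilted_right_ne_top [IsFiniteMeasure q] [SigmaFinite p]
    (hexp : Integrable (fun ω => Real.exp (f ω)) p) (hf : Integrable f q) (h : klDiv q p ≠ ∞) :
    klDiv q (p.tilted f) ≠ ∞ := by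
  obtain ⟨hac, hllr⟩ := klDiv_ne_top_iff.mp h
  exact klDiv_ne_top (hac.trans (absolutelyContinuous_tilted hexp))
    (integrable_llr_tilted_right hac hf hllr hexp)

lemma klDiv_tilted_right_ne_top_iff [IsFiniteMeasure q] [IsProbabilityMeasure p]
    (hexp : Integrable (fun ω => Real.exp (f ω)) p) (hf : Integrable f q) :
    klDiv q (p.tilted f) ≠ ∞ ↔ klDiv q p ≠ ∞ := by
  refine ⟨fun h => ?_, klDiv_tilted_right_ne_top hexp hf⟩
  have := isProbabilityMeasure_tilted hexp
  have hexp_neg : Integrable (fun ω => Real.exp ((-f) ω)) (p.tilted f) := by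
    refine (integrable_tilted_iff hexp _).mpr ((integrable_const (1 : ℝ)).congr ?_)
    exact .of_forall fun ω => by simp [← Real.exp_add]
  simpa [tilted_neg_same hexp] using klDiv_tilted_right_ne_top hexp_neg hf.neg h

theorem integral_sub_klDiv_eq_log_integral_exp_sub_klDiv_tilted [IsProbabilityMeasure q]
    [IsProbabilityMeasure p] (hexp : Integrable (fun ω => Real.exp (f ω)) p)
    (hf : Integrable f q) :
    ((∫ ω, f ω ∂q : ℝ) : EReal) - (klDiv q p : EReal) =
      ((Real.log (∫ ω, Real.exp (f ω) ∂p) : ℝ) : EReal) - (klDiv q (p.tilted f) : EReal) := by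
  have := isProbabilityMeasure_tilted hexp
  by_cases h : klDiv q p = ∞
  · have h' : klDiv q (p.tilted f) = ∞ := by
      simpa [h] using (klDiv_tilted_right_ne_top_iff hexp hf).not
    simp [h, h']
  · have h' := klDiv_tilted_right_ne_top hexp hf h
    obtain ⟨hac, hllr⟩ := klDiv_ne_top_iff.mp h
    have hkl := toReal_klDiv_of_measure_eq (klDiv_ne_top_iff.mp h').1 (by simp)
    rw [integral_llr_tilted_right hac hf hexp hllr,
      ← toReal_klDiv_of_measure_eq hac (by simp)] at hkl
    rw [← EReal.coe_ennreal_toReal h, ← EReal.coe_ennreal_toReal h', ← EReal.coe_sub,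
      ← EReal.coe_sub, EReal.coe_eq_coe_iff]
    linarith

end GibbsVariationalPrinciple

section Paths

variable {S : Type*} {T : ℝ≥0}

/-- The natural filtration of the coordinate process, indexed by all real times so that real
intervals of times need no coercions. -/
def pathFiltration (S : Type*) (T : ℝ≥0) :
    Filtration ℝ (CadlagPath.instMeasurableSpace : MeasurableSpace (CadlagPath S T)) where
  seq s := ⨆ r : {r : Set.Icc (0 : ℝ) T // (r : ℝ) ≤ s},
    MeasurableSpace.comap (fun ω : CadlagPath S T => ω r) ⊤
  mono' _ t hst := iSup_le fun r => le_iSup (fun r : {r : Set.Icc (0 : ℝ) T // (r : ℝ) ≤ t} =>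
    MeasurableSpace.comap (fun ω : CadlagPath S T => ω r) ⊤) ⟨r, r.2.trans hst⟩
  le' _ := iSup_le fun r => le_iSup (fun r : Set.Icc (0 : ℝ) T =>
    MeasurableSpace.comap (fun ω : CadlagPath S T => ω r) ⊤) r

lemma pathFiltration_endTime :
    pathFiltration S T (endTime T) = CadlagPath.instMeasurableSpace :=
  le_antisymm ((pathFiltration S T).le _) (iSup_le fun r =>
    le_iSup (fun r : {r : Set.Icc (0 : ℝ) T // (r : ℝ) ≤ endTime T} =>
      MeasurableSpace.comap (fun ω : CadlagPath S T => ω r) ⊤) ⟨r, r.2.2⟩)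

namespace CadlagPath

lemma measurable_pathFiltration_comp_apply {β : Type*} [MeasurableSpace β] {r : Set.Icc (0 : ℝ) T}
    {s : ℝ} (hrs : r ≤ s) (f : S → β) :
    Measurable[pathFiltration S T s] fun ω : CadlagPath S T => f (ω r) := by
  have h : @Measurable _ _ (pathFiltration S T s) ⊤ fun ω : CadlagPath S T => ω r :=
    Measurable.of_comap_le (le_iSup (fun r : {r : Set.Icc (0 : ℝ) T // (r : ℝ) ≤ s} =>
      MeasurableSpace.comap (fun ω : CadlagPath S T => ω r) ⊤) ⟨r, hrs⟩)
  exact (measurable_from_top (f := f)).comp h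

lemma measurable_comp_apply {β : Type*} [MeasurableSpace β] (r : Set.Icc (0 : ℝ) T) (f : S → β) :
    Measurable fun ω : CadlagPath S T => f (ω r) :=
  (measurable_pathFiltration_comp_apply le_rfl f).mono ((pathFiltration S T).le r) le_rfl

lemma measurableSet_pathFiltration_apply_eq {r : Set.Icc (0 : ℝ) T} {s : ℝ} (hrs : r ≤ s) (y : S) :
    MeasurableSet[pathFiltration S T s] {ω : CadlagPath S T | ω r = y} :=
  (@measurableSet_setOfPred _ (pathFiltration S T s) _).mpr
    (measurable_pathFiltration_comp_apply hrs (· = y))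

lemma measurableSet_apply_eq (r : Set.Icc (0 : ℝ) T) (y : S) :
    MeasurableSet {ω : CadlagPath S T | ω r = y} :=
  (pathFiltration S T).le r _ (measurableSet_pathFiltration_apply_eq le_rfl y)

end CadlagPath

/-- The cylinder sets that prescribe the path at the initial time, at `s` and at finitely many times
in between. Taking the prescribed values from a path discards exactly the empty cylinders. -/
def pastCylinders (S : Type*) {T : ℝ≥0} (s : Set.Icc (0 : ℝ) T) : Set (Set (CadlagPath S T)) :=
  {A | ∃ F : Finset (Set.Icc (0 : ℝ) T), startTime T ∈ F ∧ IsGreatest (F : Set _) s ∧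
    ∃ ω₀ : CadlagPath S T, A = {ω | ∀ r ∈ F, ω r = ω₀ r}}

lemma startTime_le (s : Set.Icc (0 : ℝ) T) : startTime T ≤ s := s.2.1

lemma isPiSystem_pastCylinders (s : Set.Icc (0 : ℝ) T) : IsPiSystem (pastCylinders S s) := by
  classical
  rintro _ ⟨F, h0, hF, ω₁, rfl⟩ _ ⟨G, -, hG, ω₂, rfl⟩ ⟨ω₀, hω₁, hω₂⟩
  refine ⟨F ∪ G, Finset.mem_union_left _ h0, ?_, ω₀, ?_⟩
  · rw [Finset.coe_union]
    simpa using hF.union hG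
  · ext ω
    simp only [Set.mem_inter_iff, Set.mem_ofPred_eq, Finset.mem_union, or_imp, forall_and] at *
    exact and_congr (forall₂_congr fun r hr => by rw [hω₁ r hr])
      (forall₂_congr fun r hr => by rw [hω₂ r hr])

lemma setOf_start_and_middle_and_end_mem_pastCylinders {r s : Set.Icc (0 : ℝ) T} (hrs : r ≤ s)
    (ω₀ : CadlagPath S T) :
    {ω | ω (startTime T) = ω₀ (startTime T) ∧ ω r = ω₀ r ∧ ω s = ω₀ s} ∈ pastCylinders S s := by
  classical
  refine ⟨{startTime T, r, s}, by simp, ⟨by simp, ?_⟩, ω₀, ?_⟩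
  · simp only [Finset.coe_insert, Finset.coe_singleton, upperBounds_insert,
      upperBounds_singleton]
    exact ⟨startTime_le s, hrs, Set.self_mem_Ici⟩
  · ext ω
    simp

lemma measurableSet_of_mem_pastCylinders {s : Set.Icc (0 : ℝ) T} {A : Set (CadlagPath S T)}
    (hA : A ∈ pastCylinders S s) : MeasurableSet[pathFiltration S T s] A := by
  obtain ⟨F, -, hF, ω₀, rfl⟩ := hA
  simp only [Set.ofPred_forall]
  exact MeasurableSet.biInter F.countable_toSet
    fun r hr => CadlagPath.measurableSet_pathFiltration_apply_eq (hF.2 hr) (ω₀ r)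

lemma pathFiltration_eq_generateFrom [Countable S] (s : Set.Icc (0 : ℝ) T) :
    pathFiltration S T s = MeasurableSpace.generateFrom (pastCylinders S s) := by
  refine le_antisymm (iSup_le ?_) (MeasurableSpace.generateFrom_le ?_)
  · rintro ⟨r, hrs⟩ _ ⟨B, -, rfl⟩
    set C : S × B × S → Set (CadlagPath S T) := fun y =>
      {ω | ω (startTime T) = y.1 ∧ ω r = y.2.1 ∧ ω s = y.2.2}
    have hunion : (fun ω : CadlagPath S T => ω r) ⁻¹' B = ⋃ y, C y := by
      ext ω
      simp only [Set.mem_preimage, Set.mem_iUnion]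
      refine ⟨fun h => ⟨(ω (startTime T), ⟨ω r, h⟩, ω s), rfl, rfl, rfl⟩, ?_⟩
      rintro ⟨y, -, h, -⟩
      exact h ▸ y.2.1.2
    rw [hunion]
    refine @MeasurableSet.iUnion _ _ (MeasurableSpace.generateFrom _) _ _ fun y => ?_
    rcases Set.eq_empty_or_nonempty (C y) with h | ⟨ω₀, h0, hr, hs⟩
    · rw [h]
      exact @MeasurableSet.empty _ (MeasurableSpace.generateFrom _)
    · simp only [C, ← h0, ← hr, ← hs]
      exact MeasurableSpace.measurableSet_generateFrom
        (setOf_start_and_middle_and_end_mem_pastCylinders hrs ω₀)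
  · exact fun A hA => measurableSet_of_mem_pastCylinders hA

lemma measure_eq_of_forall_mem_pastCylinders [Countable S] {s : Set.Icc (0 : ℝ) T}
    {μ ν : Measure (CadlagPath S T)} [IsFiniteMeasure μ] (h : ∀ A ∈ pastCylinders S s, μ A = ν A)
    {A : Set (CadlagPath S T)} (hA : MeasurableSet[pathFiltration S T s] A) : μ A = ν A := by
  have hle := (pathFiltration S T).le s
  set cover : Set (Set (CadlagPath S T)) :=
    Set.range fun ω₀ : CadlagPath S T => {ω | ω (startTime T) = ω₀ (startTime T) ∧ ω s = ω₀ s}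
  have hsub : cover ⊆ pastCylinders S s := by
    rintro _ ⟨ω₀, rfl⟩
    simpa using setOf_start_and_middle_and_end_mem_pastCylinders (le_refl s) ω₀
  have hcount : cover.Countable :=
    (Set.countable_range fun y : S × S =>
      {ω : CadlagPath S T | ω (startTime T) = y.1 ∧ ω s = y.2}).mono
        (by rintro _ ⟨ω₀, rfl⟩; exact ⟨(ω₀ (startTime T), ω₀ s), rfl⟩)
  have htrim : μ.trim hle = ν.trim hle := by
    refine Measure.ext_of_generateFrom_of_cover_subset (pathFiltration_eq_generateFrom s)
      (isPiSystem_pastCylinders s) hsub hcount ?_ (fun B _ => measure_ne_top _ B) fun B hB => ?_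
    · exact Set.eq_univ_of_forall fun ω => ⟨_, ⟨ω, rfl⟩, rfl, rfl⟩
    · rw [trim_measurableSet_eq hle (measurableSet_of_mem_pastCylinders hB),
        trim_measurableSet_eq hle (measurableSet_of_mem_pastCylinders hB), h B hB]
  rw [← trim_measurableSet_eq hle hA, htrim, trim_measurableSet_eq hle hA]

lemma exists_monotone_enumeration {α : Type*} [LinearOrder α] {F : Finset α} {a b : α}
    (ha : IsLeast (F : Set α) a) (hb : IsGreatest (F : Set α) b) :
    ∃ (n : ℕ) (e : Fin (n + 1) → α),
      Monotone e ∧ e 0 = a ∧ e (Fin.last n) = b ∧ Set.range e = F := by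
  obtain ⟨n, hn⟩ : ∃ n, F.card = n + 1 :=
    Nat.exists_eq_succ_of_ne_zero (Finset.card_ne_zero_of_mem ha.1)
  have hne : F.Nonempty := ⟨a, ha.1⟩
  refine ⟨n, F.orderEmbOfFin hn, (F.orderEmbOfFin hn).monotone, ?_, ?_, F.range_orderEmbOfFin hn⟩
  · exact (F.orderEmbOfFin_zero hn n.succ_pos).trans ((F.isLeast_min' hne).unique ha)
  · exact (F.orderEmbOfFin_last hn n.succ_pos).trans ((F.isGreatest_max' hne).unique hb)

end Paths

section MarkovLaws

lemma monotone_snoc {α : Type*} [Preorder α] {n : ℕ} {e : Fin (n + 1) → α} (he : Monotone e) {a : α}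
    (ha : e (Fin.last n) ≤ a) : Monotone (Fin.snoc e a : Fin (n + 2) → α) := by
  refine Fin.monotone_iff_le_succ.mpr (Fin.lastCases ?_ fun i => ?_)
  · simpa only [Fin.succ_last, Fin.snoc_last, Fin.snoc_castSucc] using ha
  · simpa only [Fin.succ_castSucc, Fin.snoc_castSucc] using he (Fin.castSucc_le_succ i)

lemma integrable_comp_apply {S : Type*} [Finite S] {T : ℝ≥0} {p : Measure (CadlagPath S T)}
    [IsFiniteMeasure p] (r : Set.Icc (0 : ℝ) T) (f : S → ℝ) :
    Integrable (fun ω => f (ω r)) p := by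
  have := Fintype.ofFinite S
  exact Integrable.of_bound (CadlagPath.measurable_comp_apply r f).aestronglyMeasurable ‖f‖
    (.of_forall fun ω => norm_le_pi_norm f (ω r))

lemma setIntegral_comp_apply {S : Type*} [Fintype S] {T : ℝ≥0} {p : Measure (CadlagPath S T)}
    [IsFiniteMeasure p] (A : Set (CadlagPath S T)) (r : Set.Icc (0 : ℝ) T) (f : S → ℝ) :
    ∫ ω in A, f (ω r) ∂p = ∑ z, f z * p.real (A ∩ {ω | ω r = z}) := by
  classical
  have hsum : ∀ ω : CadlagPath S T,
      f (ω r) = ∑ z, f z * Set.indicator {ω : CadlagPath S T | ω r = z} 1 ω := fun ω => by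
    simp [Set.indicator_apply]
  simp only [hsum]
  rw [integral_finsetSum]
  · refine Finset.sum_congr rfl fun z _ => ?_
    rw [integral_const_mul, integral_indicator_one (CadlagPath.measurableSet_apply_eq r z),
      measureReal_restrict_apply (CadlagPath.measurableSet_apply_eq r z), Set.inter_comm]
  · exact fun z _ => ((integrable_const (1 : ℝ)).indicator
      (CadlagPath.measurableSet_apply_eq r z)).const_mul _

namespace IsMarkovLaw

variable {S : Type*} [Fintype S] [DecidableEq S] {T : ℝ≥0} {D : Matrix S S ℝ} {x : S}
  {p : Measure (CadlagPath S T)}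

lemma measure_startTime (hp : IsMarkovLaw D x T p) (y : S) :
    p {ω | ω (startTime T) = y} = if y = x then 1 else 0 := by
  have h := hp 0 (fun _ => startTime T) (fun _ => y) monotone_const rfl
  simp only [forall_const] at h
  rw [h]
  split_ifs <;> simp

lemma isProbabilityMeasure (hp : IsMarkovLaw D x T p) : IsProbabilityMeasure p := by
  have huniv : (Set.univ : Set (CadlagPath S T)) = ⋃ y : S, {ω | ω (startTime T) = y} := by
    ext ω
    simp
  refine ⟨?_⟩
  rw [huniv, measure_iUnion ?_ (CadlagPath.measurableSet_apply_eq _), tsum_fintype]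
  · simp [hp.measure_startTime]
  · exact fun y z hyz => Set.disjoint_left.mpr fun ω hy hz => hyz (hy.symm.trans hz)

theorem unique {q : Measure (CadlagPath S T)} (hp : IsMarkovLaw D x T p)
    (hq : IsMarkovLaw D x T q) : p = q := by
  have := hp.isProbabilityMeasure
  refine Measure.ext fun A hA => ?_
  rw [← pathFiltration_endTime] at hA
  refine measure_eq_of_forall_mem_pastCylinders ?_ hA
  rintro _ ⟨F, h0, hF, ω₀, rfl⟩
  obtain ⟨n, e, he, he0, -, hrange⟩ :=
    exists_monotone_enumeration ⟨h0, fun r _ => startTime_le r⟩ hF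
  simp only [← Finset.mem_coe, ← hrange, Set.forall_mem_range]
  rw [hp n e (fun i => ω₀ (e i)) he he0, hq n e (fun i => ω₀ (e i)) he he0]

lemma measure_inter_apply_eq_of_mem_pastCylinders (hD : IsMetzler D) (hp : IsMarkovLaw D x T p)
    {s t : Set.Icc (0 : ℝ) T} (hst : s ≤ t) {F : Finset (Set.Icc (0 : ℝ) T)}
    (h0 : startTime T ∈ F) (hF : IsGreatest (F : Set (Set.Icc (0 : ℝ) T)) s)
    (ω₀ : CadlagPath S T) (z : S) :
    p ({ω | ∀ r ∈ F, ω r = ω₀ r} ∩ {ω | ω t = z}) = p {ω | ∀ r ∈ F, ω r = ω₀ r} *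
      ENNReal.ofReal (NormedSpace.exp (((t : ℝ) - s) • D) (ω₀ s) z) := by
  obtain ⟨n, e, he, he0, hes, hrange⟩ :=
    exists_monotone_enumeration ⟨h0, fun r _ => startTime_le r⟩ hF
  simp only [← Finset.mem_coe, ← hrange, Set.forall_mem_range]
  have hsnoc : {ω : CadlagPath S T | ∀ i, ω (e i) = ω₀ (e i)} ∩ {ω | ω t = z} =
      {ω | ∀ i, ω ((Fin.snoc e t : Fin (n + 2) → Set.Icc (0 : ℝ) T) i) =
        (Fin.snoc (fun i => ω₀ (e i)) z : Fin (n + 2) → S) i} := by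
    ext ω
    simp only [Set.mem_inter_iff, Set.mem_ofPred_eq, Fin.forall_fin_succ', Fin.snoc_castSucc,
      Fin.snoc_last]
  have hstart : (Fin.snoc e t : Fin (n + 2) → Set.Icc (0 : ℝ) T) 0 = startTime T := by
    rw [← he0, ← Fin.castSucc_zero, Fin.snoc_castSucc]
  have hprod : 0 ≤ (if ω₀ (e 0) = x then 1 else 0) * ∏ i : Fin n,
      NormedSpace.exp (((e i.succ : ℝ) - e i.castSucc) • D) (ω₀ (e i.castSucc)) (ω₀ (e i.succ)) :=
    mul_nonneg (by split_ifs <;> norm_num) (Finset.prod_nonneg fun i _ =>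
      (hD.smul (sub_nonneg.mpr (he (Fin.castSucc_le_succ i)))).exp_apply_nonneg _ _)
  rw [hsnoc, hp (n + 1) _ _ (monotone_snoc he (hes.trans_le hst)) hstart,
    hp n e (fun i => ω₀ (e i)) he he0, ← ENNReal.ofReal_mul hprod, Fin.prod_univ_castSucc,
    ← mul_assoc]
  simp only [Fin.snoc_castSucc, Fin.succ_castSucc, Fin.succ_last, Fin.snoc_last, hes]
  rw [← Fin.castSucc_zero, Fin.snoc_castSucc]

lemma measure_inter_apply_eq (hD : IsMetzler D) (hp : IsMarkovLaw D x T p)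
    {s t : Set.Icc (0 : ℝ) T} (hst : s ≤ t) {A : Set (CadlagPath S T)}
    (hA : MeasurableSet[pathFiltration S T s] A) (z : S) :
    p (A ∩ {ω | ω t = z}) =
      ∫⁻ ω in A, ENNReal.ofReal (NormedSpace.exp (((t : ℝ) - s) • D) (ω s) z) ∂p := by
  have := hp.isProbabilityMeasure
  have hle := (pathFiltration S T).le s
  rw [← withDensity_apply _ (hle A hA), ← Measure.restrict_apply (hle A hA)]
  refine measure_eq_of_forall_mem_pastCylinders ?_ hA
  rintro _ ⟨F, h0, hF, ω₀, rfl⟩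
  have hcyl := hle _ (measurableSet_of_mem_pastCylinders ⟨F, h0, hF, ω₀, rfl⟩)
  have hconst : Set.EqOn
      (fun ω : CadlagPath S T => ENNReal.ofReal (NormedSpace.exp (((t : ℝ) - s) • D) (ω s) z))
      (fun _ => ENNReal.ofReal (NormedSpace.exp (((t : ℝ) - s) • D) (ω₀ s) z))
      {ω | ∀ r ∈ F, ω r = ω₀ r} := fun ω hω => by
    simp only [hω s hF.1]
  rw [Measure.restrict_apply hcyl, withDensity_apply _ hcyl,
    measure_inter_apply_eq_of_mem_pastCylinders hD hp hst h0 hF, setLIntegral_congr_fun hcyl hconst,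
    setLIntegral_const, mul_comm]

lemma setIntegral_comp_apply_eq (hD : IsMetzler D) (hp : IsMarkovLaw D x T p)
    {s t : Set.Icc (0 : ℝ) T} (hst : s ≤ t) (f : S → ℝ) {A : Set (CadlagPath S T)}
    (hA : MeasurableSet[pathFiltration S T s] A) :
    ∫ ω in A, f (ω t) ∂p = ∫ ω in A, (NormedSpace.exp (((t : ℝ) - s) • D) *ᵥ f) (ω s) ∂p := by
  have := hp.isProbabilityMeasure
  set P := NormedSpace.exp (((t : ℝ) - s) • D)
  have hP : ∀ y z, 0 ≤ P y z := (hD.smul (sub_nonneg.mpr hst)).exp_apply_nonneg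
  have hreal : ∀ z, p.real (A ∩ {ω | ω t = z}) = ∫ ω in A, P (ω s) z ∂p := fun z => by
    rw [measureReal_def, hp.measure_inter_apply_eq hD hst hA, integral_eq_lintegral_of_nonneg_ae
      (.of_forall fun ω => hP _ _)
      (CadlagPath.measurable_comp_apply s (P · z)).aestronglyMeasurable]
  rw [setIntegral_comp_apply]
  simp only [hreal, Matrix.mulVec, dotProduct]
  rw [integral_finsetSum _ fun z _ =>
    ((integrable_comp_apply s (P · z)).integrableOn.mul_const (f z))]
  exact Finset.sum_congr rfl fun z _ => by rw [integral_mul_const, mul_comm]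

theorem condExp_comp_apply (hD : IsMetzler D) (hp : IsMarkovLaw D x T p)
    {s t : Set.Icc (0 : ℝ) T} (hst : s ≤ t) (f : S → ℝ) :
    p[fun ω => f (ω t) | pathFiltration S T s] =ᵐ[p]
      fun ω => (NormedSpace.exp (((t : ℝ) - s) • D) *ᵥ f) (ω s) := by
  have := hp.isProbabilityMeasure
  refine (ae_eq_condExp_of_forall_setIntegral_eq ((pathFiltration S T).le s)
    (integrable_comp_apply t f) (fun _ _ _ => (integrable_comp_apply s _).integrableOn)
    (fun A hA _ => (hp.setIntegral_comp_apply_eq hD hst f hA).symm) ?_).symm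
  exact (CadlagPath.measurable_pathFiltration_comp_apply le_rfl _).stronglyMeasurable
    |>.aestronglyMeasurable

lemma integral_mul_comp_apply (hD : IsMetzler D) (hp : IsMarkovLaw D x T p)
    {s t : Set.Icc (0 : ℝ) T} (hst : s ≤ t) (f : S → ℝ) {Φ : CadlagPath S T → ℝ}
    (hΦ : StronglyMeasurable[pathFiltration S T s] Φ) (hΦi : Integrable Φ p) :
    ∫ ω, Φ ω * f (ω t) ∂p =
      ∫ ω, Φ ω * (NormedSpace.exp (((t : ℝ) - s) • D) *ᵥ f) (ω s) ∂p := by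
  have := hp.isProbabilityMeasure
  have hf := integrable_comp_apply (p := p) t f
  have hΦf : Integrable (Φ * fun ω => f (ω t)) p :=
    hΦi.mul_bdd hf.aestronglyMeasurable (.of_forall fun ω => norm_le_pi_norm f (ω t))
  rw [← integral_condExp ((pathFiltration S T).le s)]
  refine integral_congr_ae ?_
  filter_upwards [condExp_mul_of_stronglyMeasurable_left hΦ hΦf hf, hp.condExp_comp_apply hD hst f]
    with ω hpull hmarkov
  exact hpull.trans (congrArg (Φ ω * ·) hmarkov)

end IsMarkovLaw

end MarkovLaws

section Reward

lemma exists_measurable_int_tendsto_nhdsGE : ∃ (k : ℕ → ℝ → ℤ) (c : ℕ → ℤ → ℝ),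
    (∀ n, Measurable (k n)) ∧ ∀ r, Tendsto (fun n => c n (k n r)) atTop (𝓝[≥] r) := by
  refine ⟨fun n r => ⌊((n : ℝ) + 1) * r⌋, fun n j => ((j : ℝ) + 1) / ((n : ℝ) + 1),
    fun n => Int.measurable_floor.comp (measurable_id.const_mul _), fun r => ?_⟩
  have hn : ∀ n : ℕ, (0 : ℝ) < n + 1 := fun n => n.cast_add_one_pos
  have hlower : ∀ n : ℕ, r ≤ (⌊((n : ℝ) + 1) * r⌋ + 1) / ((n : ℝ) + 1) := fun n =>
    (le_div_iff₀' (hn n)).mpr (Int.lt_floor_add_one _).le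
  have hupper : ∀ n : ℕ, (⌊((n : ℝ) + 1) * r⌋ + 1) / ((n : ℝ) + 1) ≤ r + 1 / ((n : ℝ) + 1) :=
    fun n => by
      rw [div_le_iff₀' (hn n), mul_add, mul_one_div_cancel (hn n).ne']
      linarith [Int.floor_le (((n : ℝ) + 1) * r)]
  refine tendsto_nhdsWithin_iff.mpr ⟨?_, .of_forall hlower⟩
  exact tendsto_of_tendsto_of_tendsto_of_le_of_le tendsto_const_nhds
    (by simpa using tendsto_one_div_add_atTop_nhds_zero_nat.const_add r) hlower hupper

lemma measurable_uncurry_of_continuousWithinAt_Ici {Ω E : Type*} [MeasurableSpace Ω]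
    [TopologicalSpace E] [TopologicalSpace.PseudoMetrizableSpace E] [MeasurableSpace E]
    [BorelSpace E] {Y : ℝ → Ω → E} (hY : ∀ r, Measurable (Y r))
    (hcont : ∀ ω r, ContinuousWithinAt (Y · ω) (Set.Ici r) r) :
    Measurable (Function.uncurry Y) := by
  obtain ⟨k, c, hk, hlim⟩ := exists_measurable_int_tendsto_nhdsGE
  refine measurable_of_tendsto_metrizable
    (f := fun n (z : ℝ × Ω) => Y (c n (k n z.1)) z.2) (fun n => ?_)
    (tendsto_pi_nhds.mpr fun z => (hcont z.2 z.1).tendsto.comp (hlim z.1))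
  have hcell : Measurable fun z : ℤ × Ω => Y (c n z.1) z.2 :=
    measurable_from_prod_countable_right fun j => hY (c n j)
  exact hcell.comp (((hk n).comp measurable_fst).prodMk measurable_snd)

variable {S : Type*} {T : ℝ≥0}

namespace CadlagPath

/-- The path extended from `[0, T]` to `ℝ` by its initial and terminal values. -/
noncomputable def extend (ω : CadlagPath S T) : ℝ → S := Set.IccExtend T.coe_nonneg ω

lemma extend_coe (ω : CadlagPath S T) (r : Set.Icc (0 : ℝ) T) : ω.extend r = ω r :=
  Set.IccExtend_val _ _ r

lemma eventually_extend_eq (ω : CadlagPath S T) (r : ℝ) :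
    ∀ᶠ u in 𝓝[≥] r, ω.extend u = ω.extend r := by
  have hproj : Tendsto (Set.projIcc 0 (T : ℝ) T.coe_nonneg) (𝓝[≥] r)
      (𝓝[≥] (Set.projIcc 0 (T : ℝ) T.coe_nonneg r)) :=
    continuous_projIcc.continuousWithinAt.tendsto_nhdsWithin
      fun u hu => Set.monotone_projIcc T.coe_nonneg hu
  exact hproj.eventually (ω.right_cont _)

lemma continuousWithinAt_comp_extend {E : Type*} [TopologicalSpace E] (U : S → E)
    (ω : CadlagPath S T) (r : ℝ) :
    ContinuousWithinAt (fun u => U (ω.extend u)) (Set.Ici r) r :=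
  tendsto_const_nhds.congr' ((ω.eventually_extend_eq r).mono fun _ hu => congrArg U hu.symm)

lemma measurable_pathFiltration_comp_extend {β : Type*} [MeasurableSpace β] (f : S → β) {r s : ℝ}
    (hs : 0 ≤ s) (hrs : r ≤ s) :
    Measurable[pathFiltration S T s] fun ω : CadlagPath S T => f (ω.extend r) :=
  measurable_pathFiltration_comp_apply (max_le hs ((min_le_right _ _).trans hrs)) f

lemma measurable_comp_extend {β : Type*} [MeasurableSpace β] (f : S → β) (r : ℝ) :
    Measurable fun ω : CadlagPath S T => f (ω.extend r) :=
  measurable_comp_apply _ f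

lemma intervalIntegrable_comp_extend [Finite S] (U : S → ℝ) (ω : CadlagPath S T) (a b : ℝ) :
    IntervalIntegrable (fun u => U (ω.extend u)) volume a b := by
  have := Fintype.ofFinite S
  have hmeas : Measurable fun u => U (ω.extend u) :=
    (measurable_uncurry_of_continuousWithinAt_Ici (Y := fun u (_ : Unit) => U (ω.extend u))
      (fun _ => measurable_const) fun _ => ω.continuousWithinAt_comp_extend U).comp
        (measurable_id.prodMk measurable_const : Measurable fun u : ℝ => (u, ()))
  exact intervalIntegrable_const (c := ‖U‖) |>.mono_fun hmeas.aestronglyMeasurable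
    (.of_forall fun u => by simpa using norm_le_pi_norm U (ω.extend u))

end CadlagPath

/-- The reward `∫ U(X_r) dr` collected along a path between the times `a` and `b`. -/
noncomputable def reward (U : S → ℝ) (a b : ℝ) (ω : CadlagPath S T) : ℝ :=
  ∫ r in a..b, U (ω.extend r)

lemma reward_self (U : S → ℝ) (a : ℝ) (ω : CadlagPath S T) : reward U a a ω = 0 :=
  intervalIntegral.integral_same

lemma reward_add_reward [Finite S] (U : S → ℝ) (a b c : ℝ) (ω : CadlagPath S T) :
    reward U a b ω + reward U b c ω = reward U a c ω :=
  intervalIntegral.integral_add_adjacent_intervals (ω.intervalIntegrable_comp_extend U a b)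
    (ω.intervalIntegrable_comp_extend U b c)

lemma abs_reward_le [Fintype S] (U : S → ℝ) (a b : ℝ) (ω : CadlagPath S T) :
    |reward U a b ω| ≤ ‖U‖ * |b - a| :=
  intervalIntegral.norm_integral_le_of_norm_le_const fun r _ => norm_le_pi_norm U (ω.extend r)

lemma eventually_reward_eq (U : S → ℝ) (r : ℝ) (ω : CadlagPath S T) :
    ∀ᶠ t in 𝓝[≥] r, reward U r t ω = (t - r) * U (ω.extend r) := by
  obtain ⟨b, hrb, hb⟩ := mem_nhdsGE_iff_exists_Ico_subset.mp (ω.eventually_extend_eq r)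
  filter_upwards [Ico_mem_nhdsGE hrb] with t ht
  have hconst : Set.EqOn (fun u => U (ω.extend u)) (fun _ => U (ω.extend r)) (Set.uIcc r t) :=
    fun u hu => by
      rw [Set.uIcc_of_le ht.1] at hu
      exact congrArg U (hb ⟨hu.1, hu.2.trans_lt ht.2⟩)
  rw [reward, intervalIntegral.integral_congr hconst, intervalIntegral.integral_const, smul_eq_mul]

lemma stronglyMeasurable_reward (U : S → ℝ) {a b : ℝ} (hab : a ≤ b) (hb : 0 ≤ b) :
    StronglyMeasurable[pathFiltration S T b] (reward U a b : CadlagPath S T → ℝ) := by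
  let := pathFiltration S T b
  have hstopped : Measurable (Function.uncurry fun u (ω : CadlagPath S T) =>
      U (ω.extend (min u b))) := by
    refine measurable_uncurry_of_continuousWithinAt_Ici
      (fun r => CadlagPath.measurable_pathFiltration_comp_extend U hb (min_le_right _ _))
      fun ω r => ?_
    exact (ω.continuousWithinAt_comp_extend U _).comp
      (continuous_id.min continuous_const).continuousWithinAt
      fun u hu => min_le_min_right b hu
  have hreward : (reward U a b : CadlagPath S T → ℝ) =
      fun ω => ∫ u in Set.Ioc a b, U (ω.extend (min u b)) := by
    ext ω
    rw [reward, intervalIntegral.integral_of_le hab]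
    exact setIntegral_congr_fun measurableSet_Ioc fun u hu => by simp only [min_eq_left hu.2]
  rw [hreward]
  exact hstopped.stronglyMeasurable.integral_prod_left

end Reward

section FeynmanKac

lemma abs_exp_sub_one_le_abs_mul_exp (y : ℝ) : |Real.exp y - 1| ≤ |y| * Real.exp |y| := by
  rcases le_total 0 y with hy | hy
  · rw [abs_of_nonneg hy, abs_of_nonneg (sub_nonneg.mpr (Real.one_le_exp hy))]
    have h := mul_le_mul_of_nonneg_left (Real.one_sub_le_exp_neg y) (Real.exp_nonneg y)
    rw [← Real.exp_add, add_neg_cancel, Real.exp_zero] at h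
    linarith
  · rw [abs_of_nonpos hy, abs_of_nonpos (sub_nonpos.mpr (Real.exp_le_one_iff.mpr hy))]
    have h := le_mul_of_one_le_right (neg_nonneg.mpr hy) (Real.one_le_exp (neg_nonneg.mpr hy))
    linarith [Real.add_one_le_exp y]

lemma continuousOn_of_dist_le_modulus {E : Type*} [PseudoMetricSpace E] {f : ℝ → E} {s : Set ℝ}
    {ρ : ℝ → ℝ} (hρ : Tendsto ρ (𝓝 0) (𝓝 0))
    (h : ∀ a ∈ s, ∀ b ∈ s, a ≤ b → dist (f b) (f a) ≤ ρ (b - a)) : ContinuousOn f s := by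
  intro a ha
  have hlim : Tendsto (fun b => ρ |b - a|) (𝓝[s] a) (𝓝 0) := by
    refine hρ.comp (tendsto_nhdsWithin_of_tendsto_nhds ?_)
    exact (continuous_abs.comp (continuous_id.sub continuous_const)).tendsto' a 0 (by simp)
  refine tendsto_iff_dist_tendsto_zero.mpr (squeeze_zero' (.of_forall fun _ => dist_nonneg) ?_ hlim)
  filter_upwards [self_mem_nhdsWithin] with b hb
  rcases le_total a b with hab | hba
  · rw [abs_of_nonneg (sub_nonneg.mpr hab)]
    exact h a ha b hb hab
  · rw [dist_comm, abs_sub_comm, abs_of_nonneg (sub_nonneg.mpr hba)]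
    exact h b hb a ha hba

lemma hasDerivWithinAt_integral_of_dominated {Ω E : Type*} [MeasurableSpace Ω] {μ : Measure Ω}
    [NormedAddCommGroup E] [NormedSpace ℝ E] {F : ℝ → Ω → E} {F' : Ω → E} {bound : Ω → ℝ}
    {s : Set ℝ} {r : ℝ} (hF : ∀ᶠ t in 𝓝[s] r, Integrable (F t) μ) (hFr : Integrable (F r) μ)
    (hbound : Integrable bound μ)
    (hlip : ∀ᶠ t in 𝓝[s] r, ∀ᵐ ω ∂μ, ‖F t ω - F r ω‖ ≤ bound ω * |t - r|)
    (hderiv : ∀ᵐ ω ∂μ, HasDerivWithinAt (F · ω) (F' ω) s r) :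
    HasDerivWithinAt (fun t => ∫ ω, F t ω ∂μ) (∫ ω, F' ω ∂μ) s r := by
  have hle : 𝓝[s \ {r}] r ≤ 𝓝[s] r := nhdsWithin_mono r Set.sdiff_subset
  have hslope : ∀ᶠ t in 𝓝[s \ {r}] r,
      ∫ ω, slope (F · ω) r t ∂μ = slope (fun t => ∫ ω, F t ω ∂μ) r t := by
    filter_upwards [hle hF] with t ht
    simp only [slope_def_module]
    rw [integral_smul, integral_sub ht hFr]
  rw [hasDerivWithinAt_iff_tendsto_slope]
  refine (tendsto_integral_filter_of_dominated_convergence bound ?_ ?_ hbound ?_).congr' hslope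
  · filter_upwards [hle hF] with t ht
    simp only [slope_def_module]
    exact ((ht.sub hFr).smul _).aestronglyMeasurable
  · filter_upwards [hle hlip, self_mem_nhdsWithin] with t ht htr
    filter_upwards [ht] with ω hω
    have htr' : 0 < |t - r| := abs_pos.mpr (sub_ne_zero.mpr htr.2)
    rw [slope_def_module, norm_smul, norm_inv, Real.norm_eq_abs, inv_mul_le_iff₀ htr', mul_comm]
    exact hω
  · exact hderiv.mono fun ω hω => hasDerivWithinAt_iff_tendsto_slope.mp hω

section Reward

variable {S : Type*} {T : ℝ≥0} {p : Measure (CadlagPath S T)} {U : S → ℝ} {r t : ℝ}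
  {Φ : CadlagPath S T → ℝ}

lemma abs_exp_reward_sub_one_le [Fintype S] (U : S → ℝ) (hrt : r ≤ t) (ω : CadlagPath S T) :
    |Real.exp (reward U r t ω) - 1| ≤ ‖U‖ * (t - r) * Real.exp (‖U‖ * (t - r)) := by
  have h := abs_reward_le U r t ω
  rw [abs_of_nonneg (sub_nonneg.mpr hrt)] at h
  exact (abs_exp_sub_one_le_abs_mul_exp _).trans (by gcongr)

lemma exp_reward_le [Fintype S] (U : S → ℝ) (hrt : r ≤ t) (ω : CadlagPath S T) :
    Real.exp (reward U r t ω) ≤ Real.exp (‖U‖ * (t - r)) := by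
  have h := (le_abs_self _).trans (abs_reward_le U r t ω)
  rw [abs_of_nonneg (sub_nonneg.mpr hrt)] at h
  exact Real.exp_le_exp.mpr h

lemma stronglyMeasurable_exp_reward (U : S → ℝ) (hrt : r ≤ t) (ht : 0 ≤ t) :
    StronglyMeasurable[pathFiltration S T t]
      fun ω : CadlagPath S T => Real.exp (reward U r t ω) :=
  Real.continuous_exp.comp_stronglyMeasurable (stronglyMeasurable_reward U hrt ht)

lemma integrable_mul_exp_reward [Finite S] (hΦ : Integrable Φ p) (hrt : r ≤ t) (ht : 0 ≤ t) :
    Integrable (fun ω => Φ ω * Real.exp (reward U r t ω)) p := by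
  have := Fintype.ofFinite S
  exact hΦ.mul_bdd (c := Real.exp (‖U‖ * (t - r)))
    ((stronglyMeasurable_exp_reward U hrt ht).mono ((pathFiltration S T).le t)).aestronglyMeasurable
    (.of_forall fun ω => by simpa using exp_reward_le U hrt ω)

lemma integrable_mul_exp_reward_sub_one [Finite S] (hΦ : Integrable Φ p) (hrt : r ≤ t)
    (ht : 0 ≤ t) :
    Integrable (fun ω => Φ ω * (Real.exp (reward U r t ω) - 1)) p :=
  ((integrable_mul_exp_reward hΦ hrt ht).sub hΦ).congr
    (.of_forall fun ω => (mul_sub_one (Φ ω) _).symm)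

lemma integral_abs_mul_exp_reward_le [Fintype S] (hΦ : Integrable Φ p) (hrt : r ≤ t)
    (ht : 0 ≤ t) :
    ∫ ω, |Φ ω * Real.exp (reward U r t ω)| ∂p ≤ (∫ ω, |Φ ω| ∂p) * Real.exp (‖U‖ * (t - r)) := by
  rw [← integral_mul_const]
  refine integral_mono (integrable_mul_exp_reward hΦ hrt ht).abs (hΦ.abs.mul_const _) fun ω => ?_
  rw [abs_mul, Real.abs_exp]
  exact mul_le_mul_of_nonneg_left (exp_reward_le U hrt ω) (abs_nonneg _)

lemma integrable_mul_comp_extend [Finite S] (hΦ : Integrable Φ p) (t : ℝ) (f : S → ℝ) :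
    Integrable (fun ω => Φ ω * f (ω.extend t)) p := by
  have := Fintype.ofFinite S
  exact hΦ.mul_bdd (c := ‖f‖) (CadlagPath.measurable_comp_extend f t).aestronglyMeasurable
    (.of_forall fun _ => norm_le_pi_norm f _)

lemma hasDerivWithinAt_mul_exp_reward_sub_one (U f : S → ℝ) (c s : ℝ) (ω : CadlagPath S T) :
    HasDerivWithinAt (fun t => c * (Real.exp (reward U s t ω) - 1) * f (ω.extend t))
      (c * (U * f) (ω.extend s)) (Set.Ici s) s := by
  have hexp : HasDerivAt (fun t => Real.exp ((t - s) * U (ω.extend s))) (U (ω.extend s)) s := by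
    simpa using (((hasDerivAt_id s).sub_const s).mul_const (U (ω.extend s))).exp
  have hlocal : HasDerivWithinAt
      (fun t => c * (Real.exp ((t - s) * U (ω.extend s)) - 1) * f (ω.extend s))
      (c * (U * f) (ω.extend s)) (Set.Ici s) s := by
    simpa [mul_assoc] using
      (((hexp.sub_const 1).const_mul c).mul_const (f (ω.extend s))).hasDerivWithinAt
  refine hlocal.congr_of_eventuallyEq_of_mem ?_ Set.self_mem_Ici
  filter_upwards [ω.eventually_extend_eq s, eventually_reward_eq U s ω] with t hX hR
  rw [hX, hR]

end Reward

variable {S : Type*} [DecidableEq S] {T : ℝ≥0} {D : Matrix S S ℝ} {x : S}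
  {p : Measure (CadlagPath S T)} {U : S → ℝ} {r s t : ℝ} {Φ : CadlagPath S T → ℝ}

/-- The law of `X_t` under the signed measure with density `Φ * exp (∫_s^t U(X_r) dr)` with respect
to `p`, as a row vector. It solves the forward equation of `D + diag U` in `t`. -/
noncomputable def feynmanKacLaw (p : Measure (CadlagPath S T)) (U : S → ℝ)
    (Φ : CadlagPath S T → ℝ) (s t : ℝ) : S → ℝ := fun z =>
  ∫ ω, Φ ω * Real.exp (reward U s t ω) * (Pi.single z 1 : S → ℝ) (ω.extend t) ∂p

lemma feynmanKacLaw_mul_exp_reward [Finite S] (Φ : CadlagPath S T → ℝ) (r s t : ℝ) :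
    feynmanKacLaw p U (fun ω => Φ ω * Real.exp (reward U r s ω)) s t =
      feynmanKacLaw p U Φ r t := by
  ext z
  simp only [feynmanKacLaw, mul_assoc, ← Real.exp_add, ← reward_add_reward U r s t]

variable [Fintype S]

lemma feynmanKacLaw_dotProduct (hΦ : Integrable Φ p) (hst : s ≤ t) (ht : 0 ≤ t) (f : S → ℝ) :
    feynmanKacLaw p U Φ s t ⬝ᵥ f =
      ∫ ω, Φ ω * Real.exp (reward U s t ω) * f (ω.extend t) ∂p := by
  have hsum : ∀ ω : CadlagPath S T,
      f (ω.extend t) = ∑ z, (Pi.single z 1 : S → ℝ) (ω.extend t) * f z := fun ω => by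
    simp [Pi.single_apply]
  simp only [hsum, Finset.mul_sum, ← mul_assoc]
  rw [integral_finsetSum _ fun z _ =>
    (integrable_mul_comp_extend (integrable_mul_exp_reward hΦ hst ht) t _).mul_const (f z)]
  simp only [integral_mul_const]
  rfl

lemma feynmanKacLaw_self_dotProduct (hΦ : Integrable Φ p) (ht : 0 ≤ t) (f : S → ℝ) :
    feynmanKacLaw p U Φ t t ⬝ᵥ f = ∫ ω, Φ ω * f (ω.extend t) ∂p := by
  simp only [feynmanKacLaw_dotProduct hΦ le_rfl ht, reward_self, Real.exp_zero, mul_one]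

lemma abs_feynmanKacLaw_self_dotProduct_le (hΦ : Integrable Φ p) (ht : 0 ≤ t) (f : S → ℝ) :
    |feynmanKacLaw p U Φ t t ⬝ᵥ f| ≤ (∫ ω, |Φ ω| ∂p) * ‖f‖ := by
  rw [feynmanKacLaw_self_dotProduct hΦ ht, ← integral_mul_const, ← Real.norm_eq_abs]
  refine norm_integral_le_of_norm_le (hΦ.abs.mul_const _) (.of_forall fun ω => ?_)
  rw [norm_mul]
  exact mul_le_mul_of_nonneg_left (norm_le_pi_norm f _) (abs_nonneg _)

lemma hasDerivWithinAt_integral_mul_exp_reward_sub_one (hΦ : Integrable Φ p) (hs : 0 ≤ s)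
    (f : S → ℝ) :
    HasDerivWithinAt (fun t => ∫ ω, Φ ω * (Real.exp (reward U s t ω) - 1) * f (ω.extend t) ∂p)
      (feynmanKacLaw p U Φ s s ⬝ᵥ (U * f)) (Set.Ici s) s := by
  have hintegrable : ∀ t, s ≤ t →
      Integrable (fun ω => Φ ω * (Real.exp (reward U s t ω) - 1) * f (ω.extend t)) p :=
    fun t hst => integrable_mul_comp_extend
      (integrable_mul_exp_reward_sub_one hΦ hst (hs.trans hst)) t f
  rw [feynmanKacLaw_self_dotProduct hΦ hs]
  refine hasDerivWithinAt_integral_of_dominated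
    (bound := fun ω => |Φ ω| * (‖U‖ * Real.exp ‖U‖ * ‖f‖))
    (eventually_mem_nhdsWithin.mono hintegrable) (hintegrable s le_rfl) (hΦ.abs.mul_const _) ?_
    (.of_forall fun ω => hasDerivWithinAt_mul_exp_reward_sub_one U f (Φ ω) s ω)
  filter_upwards [Icc_mem_nhdsGE (lt_add_one s)] with t ht
  refine .of_forall fun ω => ?_
  have hts : 0 ≤ t - s := sub_nonneg.mpr ht.1
  have hexp : |Real.exp (reward U s t ω) - 1| ≤ ‖U‖ * (t - s) * Real.exp ‖U‖ := by
    refine (abs_exp_reward_sub_one_le U ht.1 ω).trans ?_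
    gcongr
    exact mul_le_of_le_one_right (norm_nonneg U) (by linarith [ht.2])
  calc ‖Φ ω * (Real.exp (reward U s t ω) - 1) * f (ω.extend t) -
        Φ ω * (Real.exp (reward U s s ω) - 1) * f (ω.extend s)‖
      = |Φ ω| * |Real.exp (reward U s t ω) - 1| * ‖f (ω.extend t)‖ := by
        simp [reward_self]
    _ ≤ |Φ ω| * (‖U‖ * (t - s) * Real.exp ‖U‖) * ‖f‖ := by
        gcongr
        exact norm_le_pi_norm f _
    _ = |Φ ω| * (‖U‖ * Real.exp ‖U‖ * ‖f‖) * |t - s| := by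
        rw [abs_of_nonneg hts]
        ring

namespace IsMarkovLaw

lemma integral_mul_comp_extend (hD : IsMetzler D) (hp : IsMarkovLaw D x T p) (hs : 0 ≤ s)
    (hst : s ≤ t) (ht : t ≤ T) (f : S → ℝ) (hΦ : StronglyMeasurable[pathFiltration S T s] Φ)
    (hΦi : Integrable Φ p) :
    ∫ ω, Φ ω * f (ω.extend t) ∂p =
      ∫ ω, Φ ω * (NormedSpace.exp ((t - s) • D) *ᵥ f) (ω.extend s) ∂p := by
  lift s to Set.Icc (0 : ℝ) T using ⟨hs, hst.trans ht⟩
  lift t to Set.Icc (0 : ℝ) T using ⟨hs.trans hst, ht⟩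
  simpa only [CadlagPath.extend_coe] using hp.integral_mul_comp_apply hD hst f hΦ hΦi

lemma feynmanKacLaw_dotProduct_eq_add (hD : IsMetzler D) (hp : IsMarkovLaw D x T p) (hs : 0 ≤ s)
    (hst : s ≤ t) (ht : t ≤ T) (f : S → ℝ) (hΦ : StronglyMeasurable[pathFiltration S T s] Φ)
    (hΦi : Integrable Φ p) :
    feynmanKacLaw p U Φ s t ⬝ᵥ f =
      (∫ ω, Φ ω * (Real.exp (reward U s t ω) - 1) * f (ω.extend t) ∂p) +
        feynmanKacLaw p U Φ s s ⬝ᵥ (NormedSpace.exp ((t - s) • D) *ᵥ f) := by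
  rw [feynmanKacLaw_self_dotProduct hΦi hs, ← hp.integral_mul_comp_extend hD hs hst ht f hΦ hΦi,
    feynmanKacLaw_dotProduct hΦi hst (hs.trans hst)]
  rw [← integral_add
    (integrable_mul_comp_extend (integrable_mul_exp_reward_sub_one hΦi hst (hs.trans hst)) t f)
    (integrable_mul_comp_extend hΦi t f)]
  exact integral_congr_ae (.of_forall fun ω => by ring)

lemma abs_feynmanKacLaw_dotProduct_sub_le (hD : IsMetzler D) (hp : IsMarkovLaw D x T p)
    (hs : 0 ≤ s) (hst : s ≤ t) (ht : t ≤ T) (f : S → ℝ)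
    (hΦ : StronglyMeasurable[pathFiltration S T s] Φ) (hΦi : Integrable Φ p) :
    |feynmanKacLaw p U Φ s t ⬝ᵥ f - feynmanKacLaw p U Φ s s ⬝ᵥ f| ≤ (∫ ω, |Φ ω| ∂p) *
      (‖U‖ * (t - s) * Real.exp (‖U‖ * (t - s)) * ‖f‖ +
        ‖NormedSpace.exp ((t - s) • D) *ᵥ f - f‖) := by
  rw [hp.feynmanKacLaw_dotProduct_eq_add hD hs hst ht f hΦ hΦi, add_sub_assoc, ← dotProduct_sub,
    mul_add]
  refine (abs_add_le _ _).trans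
    (add_le_add ?_ (abs_feynmanKacLaw_self_dotProduct_le hΦi hs _))
  rw [← integral_mul_const, ← Real.norm_eq_abs]
  refine norm_integral_le_of_norm_le (hΦi.abs.mul_const _) (.of_forall fun ω => ?_)
  rw [norm_mul, norm_mul, mul_assoc]
  exact mul_le_mul_of_nonneg_left (mul_le_mul (abs_exp_reward_sub_one_le U hst ω)
    (norm_le_pi_norm f _) (norm_nonneg _)
    ((abs_nonneg _).trans (abs_exp_reward_sub_one_le U hst ω))) (abs_nonneg _)

lemma continuousOn_feynmanKacLaw (hD : IsMetzler D) (hp : IsMarkovLaw D x T p) (hs : 0 ≤ s)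
    (ht : t ≤ T) (hΦ : StronglyMeasurable[pathFiltration S T s] Φ) (hΦi : Integrable Φ p) :
    ContinuousOn (feynmanKacLaw p U Φ s) (Set.Icc s t) := by
  refine continuousOn_pi.mpr fun z => ?_
  set f : S → ℝ := Pi.single z 1
  set K : ℝ := (∫ ω, |Φ ω| ∂p) * Real.exp (‖U‖ * (t - s))
  have hρ : Tendsto (fun h : ℝ => K * (‖U‖ * h * Real.exp (‖U‖ * h) * ‖f‖ +
      ‖NormedSpace.exp (h • D) *ᵥ f - f‖)) (𝓝 0) (𝓝 0) := by
    have hcont := continuous_exp_smul_mulVec D f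
    refine Continuous.tendsto' (by fun_prop) 0 0 ?_
    simp
  refine continuousOn_of_dist_le_modulus hρ fun a ha b hb hab => ?_
  have ha0 := hs.trans ha.1
  have hmeas : StronglyMeasurable[pathFiltration S T a]
      fun ω => Φ ω * Real.exp (reward U s a ω) :=
    (hΦ.mono ((pathFiltration S T).mono ha.1)).mul (stronglyMeasurable_exp_reward U ha.1 ha0)
  have hintegrable := integrable_mul_exp_reward (U := U) hΦi ha.1 ha0
  have hbound := hp.abs_feynmanKacLaw_dotProduct_sub_le (U := U) hD ha0 hab (hb.2.trans ht) f
    hmeas hintegrable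
  simp only [feynmanKacLaw_mul_exp_reward, f, dotProduct_single_one] at hbound
  refine hbound.trans (mul_le_mul_of_nonneg_right ?_ ?_)
  · refine (integral_abs_mul_exp_reward_le hΦi ha.1 ha0).trans ?_
    simp only [K]
    gcongr
    exact ha.2
  · have := sub_nonneg.mpr hab
    positivity

lemma hasDerivWithinAt_feynmanKacLaw_dotProduct_self (hD : IsMetzler D) (hp : IsMarkovLaw D x T p)
    (hs : 0 ≤ s) (hsT : s < T) (hΦ : StronglyMeasurable[pathFiltration S T s] Φ)
    (hΦi : Integrable Φ p) (f : S → ℝ) :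
    HasDerivWithinAt (fun t => feynmanKacLaw p U Φ s t ⬝ᵥ f)
      (feynmanKacLaw p U Φ s s ⬝ᵥ ((D + Matrix.diagonal U) *ᵥ f)) (Set.Ici s) s := by
  have hreward := hasDerivWithinAt_integral_mul_exp_reward_sub_one (U := U) hΦi hs f
  have hjump : HasDerivAt
      (fun t => feynmanKacLaw p U Φ s s ⬝ᵥ (NormedSpace.exp ((t - s) • D) *ᵥ f))
      (feynmanKacLaw p U Φ s s ⬝ᵥ (D *ᵥ f)) s := by
    have h : HasDerivAt (fun t => NormedSpace.exp ((t - s) • D) *ᵥ f) (D *ᵥ f) s :=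
      HasDerivAt.comp_sub_const s s (by rw [sub_self]; exact hasDerivAt_exp_smul_mulVec D f)
    exact HasDerivAt.fun_sum fun z _ => (hasDerivAt_pi.mp h z).const_mul _
  have hderiv : feynmanKacLaw p U Φ s s ⬝ᵥ ((D + Matrix.diagonal U) *ᵥ f) =
      feynmanKacLaw p U Φ s s ⬝ᵥ (U * f) + feynmanKacLaw p U Φ s s ⬝ᵥ (D *ᵥ f) := by
    have hdiag : Matrix.diagonal U *ᵥ f = U * f := funext fun z => Matrix.mulVec_diagonal U f z
    rw [Matrix.add_mulVec, dotProduct_add, add_comm, hdiag]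
  rw [hderiv]
  refine (hreward.add hjump.hasDerivWithinAt).congr_of_eventuallyEq_of_mem ?_ Set.self_mem_Ici
  filter_upwards [Icc_mem_nhdsGE hsT] with t ht
  exact hp.feynmanKacLaw_dotProduct_eq_add hD hs ht.1 ht.2 f hΦ hΦi

lemma hasDerivWithinAt_feynmanKacLaw (hD : IsMetzler D) (hp : IsMarkovLaw D x T p)
    (hs : 0 ≤ s) (hsr : s ≤ r) (hrT : r < T) (hΦ : StronglyMeasurable[pathFiltration S T s] Φ)
    (hΦi : Integrable Φ p) :
    HasDerivWithinAt (feynmanKacLaw p U Φ s)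
      (feynmanKacLaw p U Φ s r ᵥ* (D + Matrix.diagonal U)) (Set.Ici r) r := by
  refine hasDerivWithinAt_pi.mpr fun z => ?_
  have hr := hs.trans hsr
  have hmeas : StronglyMeasurable[pathFiltration S T r]
      fun ω => Φ ω * Real.exp (reward U s r ω) :=
    (hΦ.mono ((pathFiltration S T).mono hsr)).mul (stronglyMeasurable_exp_reward U hsr hr)
  have h := hp.hasDerivWithinAt_feynmanKacLaw_dotProduct_self (U := U) hD hr hrT hmeas
    (integrable_mul_exp_reward hΦi hsr hr) (Pi.single z 1)
  simpa only [feynmanKacLaw_mul_exp_reward, Matrix.dotProduct_mulVec, dotProduct_single_one] using h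

theorem feynmanKac (hD : IsMetzler D) (hp : IsMarkovLaw D x T p) (hs : 0 ≤ s) (hst : s ≤ t)
    (ht : t ≤ T) (hΦ : StronglyMeasurable[pathFiltration S T s] Φ) (hΦi : Integrable Φ p)
    (f : S → ℝ) :
    ∫ ω, Φ ω * Real.exp (reward U s t ω) * f (ω.extend t) ∂p =
      ∫ ω, Φ ω * (NormedSpace.exp ((t - s) • (D + Matrix.diagonal U)) *ᵥ f) (ω.extend s) ∂p := by
  have hforward := eq_vecMul_exp_of_hasDerivWithinAt hst
    (hp.continuousOn_feynmanKacLaw (U := U) hD hs ht hΦ hΦi)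
    fun r hr => hp.hasDerivWithinAt_feynmanKacLaw hD hs hr.1 (hr.2.trans_le ht) hΦ hΦi
  rw [← feynmanKacLaw_dotProduct hΦi hst (hs.trans hst), hforward, ← Matrix.dotProduct_mulVec,
    feynmanKacLaw_self_dotProduct hΦi hs]

end IsMarkovLaw

end FeynmanKac

section TwistedLaw

lemma CadlagPath.measurableSet_pathFiltration_cylinder {S : Type*} {T : ℝ≥0} {ι : Type*}
    [Countable ι] {t : ι → Set.Icc (0 : ℝ) T} {s : ℝ} (hts : ∀ i, t i ≤ s) (y : ι → S) :
    MeasurableSet[pathFiltration S T s] {ω : CadlagPath S T | ∀ i, ω (t i) = y i} := by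
  rw [Set.ofPred_forall]
  exact MeasurableSet.iInter fun i => measurableSet_pathFiltration_apply_eq (hts i) (y i)

lemma abs_log_div_le {S : Type*} [Fintype S] (v : S → ℝ) (y z : S) :
    |Real.log (v y / v z)| ≤ ‖fun a : S × S => Real.log (v a.1 / v a.2)‖ :=
  norm_le_pi_norm (fun a : S × S => Real.log (v a.1 / v a.2)) (y, z)

/-- The logarithm of the density process `exp (∫_0^t (U(X_r) - Λ) dr) * v(X_t) / v(X_0)` of the
twisted process with respect to the original one. -/
noncomputable def twistLogDensity {S : Type*} {T : ℝ≥0} (U : S → ℝ) (Λ : ℝ) (v : S → ℝ) (t : ℝ)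
    (ω : CadlagPath S T) : ℝ :=
  reward U 0 t ω - t * Λ + Real.log (v (ω.extend t) / v (ω.extend 0))

section Path

variable {S : Type*} {T : ℝ≥0} {p : Measure (CadlagPath S T)} {U v : S → ℝ} {Λ t : ℝ}

lemma exp_twistLogDensity (hv : ∀ y, 0 < v y) (t : ℝ) (ω : CadlagPath S T) :
    Real.exp (twistLogDensity U Λ v t ω) =
      Real.exp (reward U 0 t ω) * Real.exp (-(t * Λ)) * (v (ω.extend t) / v (ω.extend 0)) := by
  rw [twistLogDensity, Real.exp_add, Real.exp_log (div_pos (hv _) (hv _)), sub_eq_add_neg,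
    Real.exp_add]

lemma twistLogDensity_zero (hv : ∀ y, 0 < v y) (ω : CadlagPath S T) :
    twistLogDensity U Λ v 0 ω = 0 := by
  simp [twistLogDensity, reward_self, (hv _).ne']

lemma stronglyMeasurable_twistLogDensity (U : S → ℝ) (Λ : ℝ) (v : S → ℝ) (ht : 0 ≤ t) :
    StronglyMeasurable (twistLogDensity U Λ v t : CadlagPath S T → ℝ) := by
  have hreward := (stronglyMeasurable_reward (T := T) U ht ht).mono ((pathFiltration S T).le t)
  have hstart := CadlagPath.measurable_comp_extend (T := T) v 0
  have hend := CadlagPath.measurable_comp_extend (T := T) v t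
  exact (hreward.sub stronglyMeasurable_const).add (hend.div hstart).log.stronglyMeasurable

lemma abs_twistLogDensity_le [Fintype S] (U : S → ℝ) (Λ : ℝ) (v : S → ℝ) (t : ℝ)
    (ω : CadlagPath S T) :
    |twistLogDensity U Λ v t ω| ≤
      ‖U‖ * |t| + |t * Λ| + ‖fun a : S × S => Real.log (v a.1 / v a.2)‖ := by
  have h := abs_reward_le U 0 t ω
  rw [sub_zero] at h
  exact (abs_add_le _ _).trans
    (add_le_add ((abs_sub _ _).trans (add_le_add_left h _)) (abs_log_div_le v _ _))

lemma integrable_twistLogDensity [Finite S] [IsFiniteMeasure p] (U : S → ℝ) (Λ : ℝ) (v : S → ℝ)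
    (ht : 0 ≤ t) : Integrable (twistLogDensity U Λ v t) p := by
  have := Fintype.ofFinite S
  exact .of_bound (stronglyMeasurable_twistLogDensity U Λ v ht).aestronglyMeasurable _
    (.of_forall (abs_twistLogDensity_le U Λ v t))

lemma integrable_exp_twistLogDensity [Finite S] [IsFiniteMeasure p] (U : S → ℝ) (Λ : ℝ)
    (v : S → ℝ) (ht : 0 ≤ t) : Integrable (fun ω => Real.exp (twistLogDensity U Λ v t ω)) p := by
  have := Fintype.ofFinite S
  refine .of_bound
    (C := Real.exp (‖U‖ * |t| + |t * Λ| + ‖fun a : S × S => Real.log (v a.1 / v a.2)‖))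
    (Real.continuous_exp.comp_stronglyMeasurable
      (stronglyMeasurable_twistLogDensity U Λ v ht)).aestronglyMeasurable (.of_forall fun ω => ?_)
  rw [Real.norm_eq_abs, Real.abs_exp]
  exact Real.exp_le_exp.mpr ((le_abs_self _).trans (abs_twistLogDensity_le U Λ v t ω))

end Path

namespace IsMarkovLaw

variable {S : Type*} [Fintype S] [DecidableEq S] {T : ℝ≥0} {p : Measure (CadlagPath S T)}
  {D : Matrix S S ℝ} {x : S} {U v : S → ℝ} {Λ s t : ℝ}

lemma integral_mul_exp_twistLogDensity_mul (hD : IsMetzler D) (hp : IsMarkovLaw D x T p)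
    (hv : ∀ y, 0 < v y) (hs : 0 ≤ s) (hst : s ≤ t) (ht : t ≤ T) {Φ : CadlagPath S T → ℝ}
    (hΦ : StronglyMeasurable[pathFiltration S T s] Φ) (hΦi : Integrable Φ p) (f : S → ℝ) :
    ∫ ω, Φ ω * Real.exp (twistLogDensity U Λ v t ω) * f (ω.extend t) ∂p =
      ∫ ω, Φ ω * Real.exp (twistLogDensity U Λ v s ω) *
        (NormedSpace.exp ((t - s) • twistedGenerator D U Λ v) *ᵥ f) (ω.extend s) ∂p := by
  set Ψ : CadlagPath S T → ℝ := fun ω =>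
    Φ ω * Real.exp (reward U 0 s ω) * v⁻¹ (ω.extend 0) * Real.exp (-(t * Λ)) with hΨ
  have hmeas : StronglyMeasurable[pathFiltration S T s] Ψ :=
    ((hΦ.mul (stronglyMeasurable_exp_reward U hs hs)).mul
      (CadlagPath.measurable_pathFiltration_comp_extend v⁻¹ hs hs).stronglyMeasurable).mul
      stronglyMeasurable_const
  have hintegrable : Integrable Ψ p :=
    (integrable_mul_comp_extend (integrable_mul_exp_reward hΦi hs hs) 0 v⁻¹).mul_const _
  have hFK := hp.feynmanKac (U := U) hD hs hst ht hmeas hintegrable (v * f)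
  rw [exp_smul_mulVec_mul (Λ := Λ) hv] at hFK
  refine (integral_congr_ae (.of_forall fun ω => ?_)).trans
    (hFK.trans (integral_congr_ae (.of_forall fun ω => ?_)))
  · simp only [hΨ, exp_twistLogDensity hv, ← reward_add_reward U 0 s t ω, Real.exp_add,
      Pi.mul_apply, Pi.inv_apply, div_eq_mul_inv]
    ring
  · have hexp : Real.exp (-(s * Λ)) = Real.exp (-(t * Λ)) * Real.exp ((t - s) * Λ) := by
      rw [← Real.exp_add]
      ring_nf
    simp only [hΨ, exp_twistLogDensity hv, hexp, Pi.smul_apply, Pi.mul_apply, Pi.inv_apply,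
      smul_eq_mul, div_eq_mul_inv]
    ring

lemma setIntegral_exp_twistLogDensity_mul (hD : IsMetzler D) (hp : IsMarkovLaw D x T p)
    (hv : ∀ y, 0 < v y) (hs : 0 ≤ s) (hst : s ≤ t) (ht : t ≤ T) {A : Set (CadlagPath S T)}
    (hA : MeasurableSet[pathFiltration S T s] A) (f : S → ℝ) :
    ∫ ω in A, Real.exp (twistLogDensity U Λ v t ω) * f (ω.extend t) ∂p =
      ∫ ω in A, Real.exp (twistLogDensity U Λ v s ω) *
        (NormedSpace.exp ((t - s) • twistedGenerator D U Λ v) *ᵥ f) (ω.extend s) ∂p := by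
  have := hp.isProbabilityMeasure
  have hA' := (pathFiltration S T).le s A hA
  have h := hp.integral_mul_exp_twistLogDensity_mul (U := U) (Λ := Λ) hD hv hs hst ht
    (stronglyMeasurable_const.indicator hA) ((integrable_const (1 : ℝ)).indicator hA') f
  have hindicator : ∀ g : CadlagPath S T → ℝ,
      (fun ω => A.indicator (fun _ => (1 : ℝ)) ω * g ω) = A.indicator g := fun g => by
    ext ω
    by_cases hω : ω ∈ A <;> simp [hω]
  simpa only [mul_assoc, hindicator, integral_indicator hA'] using h

lemma setIntegral_exp_twistLogDensity (hD : IsMetzler D) (hp : IsMarkovLaw D x T p)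
    (hv : ∀ y, 0 < v y) (hDv : (D + Matrix.diagonal U) *ᵥ v = Λ • v) (hs : 0 ≤ s) (hst : s ≤ t)
    (ht : t ≤ T) {A : Set (CadlagPath S T)} (hA : MeasurableSet[pathFiltration S T s] A) :
    ∫ ω in A, Real.exp (twistLogDensity U Λ v t ω) ∂p =
      ∫ ω in A, Real.exp (twistLogDensity U Λ v s ω) ∂p := by
  have h := hp.setIntegral_exp_twistLogDensity_mul (U := U) (Λ := Λ) hD hv hs hst ht hA 1
  rw [(isRateMatrix_twistedGenerator hD hv hDv).exp_smul_mulVec_one] at h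
  simpa using h

lemma integral_exp_twistLogDensity (hD : IsMetzler D) (hp : IsMarkovLaw D x T p)
    (hv : ∀ y, 0 < v y) (hDv : (D + Matrix.diagonal U) *ᵥ v = Λ • v) (ht : 0 ≤ t) (htT : t ≤ T) :
    ∫ ω, Real.exp (twistLogDensity U Λ v t ω) ∂p = 1 := by
  have := hp.isProbabilityMeasure
  have h := hp.setIntegral_exp_twistLogDensity (U := U) (Λ := Λ) hD hv hDv le_rfl ht htT .univ
  simpa [twistLogDensity_zero hv] using h

lemma setIntegral_inter_apply_eq_exp_twistLogDensity (hD : IsMetzler D) (hp : IsMarkovLaw D x T p)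
    (hv : ∀ y, 0 < v y) {s t : Set.Icc (0 : ℝ) T} (hst : s ≤ t) {A : Set (CadlagPath S T)}
    (hA : MeasurableSet[pathFiltration S T s] A) {y : S} (hAy : ∀ ω ∈ A, ω s = y) (z : S) :
    ∫ ω in A ∩ {ω | ω t = z}, Real.exp (twistLogDensity U Λ v t ω) ∂p =
      (∫ ω in A, Real.exp (twistLogDensity U Λ v s ω) ∂p) *
        NormedSpace.exp (((t : ℝ) - s) • twistedGenerator D U Λ v) y z := by
  have h := hp.setIntegral_exp_twistLogDensity_mul (U := U) (Λ := Λ) hD hv s.2.1 hst t.2.2 hA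
    (Pi.single z 1)
  simp only [CadlagPath.extend_coe, Matrix.mulVec_single_one, Matrix.col_apply] at h
  have hindicator : ∀ ω : CadlagPath S T,
      {ω | ω t = z}.indicator (fun ω => Real.exp (twistLogDensity U Λ v t ω)) ω =
        Real.exp (twistLogDensity U Λ v t ω) * (Pi.single z 1 : S → ℝ) (ω t) := fun ω => by
    simp [Set.indicator_apply, Pi.single_apply]
  rw [← setIntegral_indicator (CadlagPath.measurableSet_apply_eq t z), ← integral_mul_const]
  simp only [hindicator]
  rw [h]
  exact setIntegral_congr_fun ((pathFiltration S T).le s A hA) fun ω hω => by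
    simp only [hAy ω hω]

lemma setIntegral_cylinder_exp_twistLogDensity (hD : IsMetzler D) (hp : IsMarkovLaw D x T p)
    (hv : ∀ y, 0 < v y) (n : ℕ) (t : Fin (n + 1) → Set.Icc (0 : ℝ) T) (y : Fin (n + 1) → S)
    (ht : Monotone t) (ht0 : t 0 = startTime T) :
    ∫ ω in {ω | ∀ i, ω (t i) = y i}, Real.exp (twistLogDensity U Λ v (t (Fin.last n)) ω) ∂p =
      (if y 0 = x then 1 else 0) * ∏ i : Fin n,
        NormedSpace.exp (((t i.succ : ℝ) - t i.castSucc) • twistedGenerator D U Λ v)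
          (y i.castSucc) (y i.succ) := by
  induction n with
  | zero =>
    have hstart : ∀ ω : CadlagPath S T, twistLogDensity U Λ v (startTime T) ω = 0 :=
      twistLogDensity_zero hv
    simp [hstart, Fin.forall_fin_one, ht0, measureReal_def, hp.measure_startTime,
      apply_ite ENNReal.toReal]
  | succ n ih =>
    have hcylinder : {ω : CadlagPath S T | ∀ i, ω (t i) = y i} =
        {ω | ∀ i : Fin (n + 1), ω (t i.castSucc) = y i.castSucc} ∩
          {ω | ω (t (Fin.last (n + 1))) = y (Fin.last (n + 1))} :=
      Set.ext fun ω => Fin.forall_fin_succ'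
    rw [hcylinder, hp.setIntegral_inter_apply_eq_exp_twistLogDensity hD hv (ht (Fin.le_last _))
      (CadlagPath.measurableSet_pathFiltration_cylinder
        (fun i => ht (Fin.castSucc_le_castSucc_iff.mpr (Fin.le_last i))) _)
      (fun ω hω => hω (Fin.last n)),
      ih _ _ (fun i j hij => ht (Fin.castSucc_le_castSucc_iff.mpr hij)) ht0,
      Fin.prod_univ_castSucc, mul_assoc]
    rfl

theorem tilted_twistLogDensity (hD : IsMetzler D) (hp : IsMarkovLaw D x T p) (hv : ∀ y, 0 < v y)
    (hDv : (D + Matrix.diagonal U) *ᵥ v = Λ • v) :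
    IsMarkovLaw (twistedGenerator D U Λ v) x T (p.tilted (twistLogDensity U Λ v T)) := by
  intro n t y ht ht0
  have := hp.isProbabilityMeasure
  have hA : MeasurableSet[pathFiltration S T (t (Fin.last n))]
      {ω : CadlagPath S T | ∀ i, ω (t i) = y i} :=
    CadlagPath.measurableSet_pathFiltration_cylinder (fun i => ht (Fin.le_last i)) y
  rw [tilted_apply_eq_ofReal_integral' _ ((pathFiltration S T).le _ _ hA),
    hp.integral_exp_twistLogDensity hD hv hDv T.coe_nonneg le_rfl]
  simp only [div_one]
  rw [hp.setIntegral_exp_twistLogDensity hD hv hDv (t (Fin.last n)).2.1 (t (Fin.last n)).2.2 le_rfl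
    hA, hp.setIntegral_cylinder_exp_twistLogDensity hD hv n t y ht ht0]

end IsMarkovLaw

end TwistedLaw

section Welfare

open InformationTheory

lemma sub_coe_ennreal_le_self (a : EReal) (b : ℝ≥0∞) : a - b ≤ a :=
  (EReal.sub_le_sub le_rfl (EReal.coe_ennreal_nonneg b)).trans_eq (sub_zero a)

variable {S : Type*} {T : ℝ≥0} {p q : Measure (CadlagPath S T)} {U v : S → ℝ} {Λ : ℝ}

lemma integrable_reward [Finite S] [IsFiniteMeasure p] (U : S → ℝ) :
    Integrable (reward U 0 T) p := by
  have := Fintype.ofFinite S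
  exact .of_bound ((stronglyMeasurable_reward U T.coe_nonneg T.coe_nonneg).mono
    ((pathFiltration S T).le T)).aestronglyMeasurable _ (.of_forall (abs_reward_le U 0 T))

lemma integrable_exp_reward [Finite S] [IsFiniteMeasure p] (U : S → ℝ) :
    Integrable (fun ω => Real.exp (reward U 0 T ω)) p := by
  simpa using integrable_mul_exp_reward (U := U) (integrable_const (1 : ℝ)) T.coe_nonneg
    T.coe_nonneg

lemma welfare_eq_log_integral_exp_sub_klDiv_tilted [Finite S] [IsProbabilityMeasure p]
    [IsProbabilityMeasure q] (U : S → ℝ) :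
    welfare U p q = ((Real.log (∫ ω, Real.exp (reward U 0 T ω) ∂p) : ℝ) : EReal) -
      (klDiv q (p.tilted (reward U 0 T)) : EReal) :=
  integral_sub_klDiv_eq_log_integral_exp_sub_klDiv_tilted (integrable_exp_reward U)
    (integrable_reward U)

lemma isWelfareOptimal_tilted_reward [Finite S] [IsProbabilityMeasure p] (U : S → ℝ) :
    IsWelfareOptimal U p (p.tilted (reward U 0 T)) := by
  have := isProbabilityMeasure_tilted (integrable_exp_reward (p := p) U)
  refine ⟨this, fun q hq => ?_⟩
  rw [welfare_eq_log_integral_exp_sub_klDiv_tilted, welfare_eq_log_integral_exp_sub_klDiv_tilted,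
    klDiv_self, EReal.coe_ennreal_zero, sub_zero]
  exact sub_coe_ennreal_le_self _ _

lemma integrable_log_div [Finite S] [IsFiniteMeasure q] (v : S → ℝ) (r s : Set.Icc (0 : ℝ) T) :
    Integrable (fun ω => Real.log (v (ω r) / v (ω s))) q := by
  have := Fintype.ofFinite S
  have hmeas : Measurable fun ω : CadlagPath S T => Real.log (v (ω r) / v (ω s)) :=
    ((CadlagPath.measurable_comp_apply r v).div (CadlagPath.measurable_comp_apply s v)).log
  exact .of_bound hmeas.aestronglyMeasurable _ (.of_forall fun ω => abs_log_div_le v (ω r) (ω s))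

lemma abs_integral_log_div_le [Fintype S] [IsProbabilityMeasure q] (v : S → ℝ)
    (r s : Set.Icc (0 : ℝ) T) :
    |∫ ω, Real.log (v (ω r) / v (ω s)) ∂q| ≤ ‖fun a : S × S => Real.log (v a.1 / v a.2)‖ := by
  have hbound : ∀ ω : CadlagPath S T, ‖Real.log (v (ω r) / v (ω s))‖ ≤
      ‖fun a : S × S => Real.log (v a.1 / v a.2)‖ := fun ω => abs_log_div_le v (ω r) (ω s)
  simpa using norm_integral_le_of_norm_le_const (μ := q) (.of_forall hbound)

lemma integral_twistLogDensity [Finite S] [IsProbabilityMeasure q] (U : S → ℝ) (Λ : ℝ)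
    (v : S → ℝ) :
    ∫ ω, twistLogDensity U Λ v T ω ∂q = (∫ ω, reward U 0 T ω ∂q) - T * Λ +
      ∫ ω, Real.log (v (ω (endTime T)) / v (ω (startTime T))) ∂q := by
  have hlog := integrable_log_div (q := q) v (endTime T) (startTime T)
  have hreward := integrable_reward (p := q) U
  calc ∫ ω, twistLogDensity U Λ v T ω ∂q
      = ∫ ω, (reward U 0 T ω - T * Λ +
          Real.log (v (ω (endTime T)) / v (ω (startTime T)))) ∂q := by
        simp only [← CadlagPath.extend_coe]
        rfl
    _ = _ := by
        rw [integral_add (f := fun ω => reward U 0 T ω - T * Λ)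
          (hreward.sub (integrable_const _)) hlog, integral_sub hreward (integrable_const _)]
        simp

namespace IsMarkovLaw

variable [Fintype S] [DecidableEq S] {D : Matrix S S ℝ} {x : S}

theorem welfare_eq_sub_klDiv_tilted [IsProbabilityMeasure q] (hD : IsMetzler D)
    (hp : IsMarkovLaw D x T p) (hv : ∀ y, 0 < v y)
    (hDv : (D + Matrix.diagonal U) *ᵥ v = Λ • v) :
    welfare U p q =
      ((T * Λ - ∫ ω, Real.log (v (ω (endTime T)) / v (ω (startTime T))) ∂q : ℝ) : EReal) -
        (klDiv q (p.tilted (twistLogDensity U Λ v T)) : EReal) := by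
  have := hp.isProbabilityMeasure
  set L := ∫ ω, Real.log (v (ω (endTime T)) / v (ω (startTime T))) ∂q
  have hgibbs := integral_sub_klDiv_eq_log_integral_exp_sub_klDiv_tilted (q := q)
    (integrable_exp_twistLogDensity (p := p) U Λ v T.coe_nonneg)
    (integrable_twistLogDensity U Λ v T.coe_nonneg)
  rw [integral_twistLogDensity, hp.integral_exp_twistLogDensity hD hv hDv T.coe_nonneg le_rfl,
    Real.log_one] at hgibbs
  have hreward : ∫ ω, reward U 0 T ω ∂q =
      (T * Λ - L) + ((∫ ω, reward U 0 T ω ∂q) - T * Λ + L) := by ring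
  change ((∫ ω, reward U 0 T ω ∂q : ℝ) : EReal) - _ = _
  rw [hreward, EReal.coe_add, add_sub_assoc, hgibbs, EReal.coe_zero, zero_sub, ← sub_eq_add_neg]

lemma welfare_twisted (hD : IsMetzler D) (hp : IsMarkovLaw D x T p) (hv : ∀ y, 0 < v y)
    (hDv : (D + Matrix.diagonal U) *ᵥ v = Λ • v)
    (hq : IsMarkovLaw (twistedGenerator D U Λ v) x T q) :
    welfare U p q =
      ((T * Λ - ∫ ω, Real.log (v (ω (endTime T)) / v (ω (startTime T))) ∂q : ℝ) : EReal) := by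
  have := hq.isProbabilityMeasure
  rw [hp.welfare_eq_sub_klDiv_tilted hD hv hDv, ← hq.unique (hp.tilted_twistLogDensity hD hv hDv),
    klDiv_self, EReal.coe_ennreal_zero, sub_zero]

lemma welfare_le [IsProbabilityMeasure q] (hD : IsMetzler D) (hp : IsMarkovLaw D x T p)
    (hv : ∀ y, 0 < v y) (hDv : (D + Matrix.diagonal U) *ᵥ v = Λ • v) :
    welfare U p q ≤ ((T * Λ + ‖fun a : S × S => Real.log (v a.1 / v a.2)‖ : ℝ) : EReal) := by
  rw [hp.welfare_eq_sub_klDiv_tilted hD hv hDv]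
  refine (sub_coe_ennreal_le_self _ _).trans (EReal.coe_le_coe_iff.mpr ?_)
  linarith [neg_le_of_abs_le (abs_integral_log_div_le (q := q) v (endTime T) (startTime T))]

lemma le_welfare_twisted (hD : IsMetzler D) (hp : IsMarkovLaw D x T p) (hv : ∀ y, 0 < v y)
    (hDv : (D + Matrix.diagonal U) *ᵥ v = Λ • v)
    (hq : IsMarkovLaw (twistedGenerator D U Λ v) x T q) :
    ((T * Λ - ‖fun a : S × S => Real.log (v a.1 / v a.2)‖ : ℝ) : EReal) ≤ welfare U p q := by
  have := hq.isProbabilityMeasure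
  rw [hp.welfare_twisted hD hv hDv hq, EReal.coe_le_coe_iff]
  linarith [le_of_abs_le (abs_integral_log_div_le (q := q) v (endTime T) (startTime T))]

end IsMarkovLaw

lemma hasAverageWelfare_of_le_of_le {S : Type*} {U : S → ℝ} {Λ : ℝ}
    {p0 p : ∀ T : ℝ≥0, Measure (CadlagPath S T)} {C : ℝ}
    (hle : ∀ T : ℝ≥0, ((T * Λ - C : ℝ) : EReal) ≤ welfare U (p0 T) (p T))
    (hge : ∀ T : ℝ≥0, welfare U (p0 T) (p T) ≤ ((T * Λ + C : ℝ) : EReal)) :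
    HasAverageWelfare U p0 p Λ := by
  have hlim : ∀ c : ℝ, Tendsto (fun T : ℝ≥0 => ((T * Λ + c : ℝ) : EReal) / ((T : ℝ) : EReal)) atTop
      (𝓝 (Λ : EReal)) := fun c => by
    have h : Tendsto (fun T : ℝ≥0 => Λ + c / (T : ℝ)) atTop (𝓝 (Λ + 0)) :=
      tendsto_const_nhds.add
        (tendsto_const_nhds.div_atTop (NNReal.tendsto_coe_atTop.mpr tendsto_id))
    rw [add_zero] at h
    refine ((continuous_coe_real_ereal.tendsto Λ).comp h).congr' ?_
    filter_upwards [eventually_gt_atTop 0] with T hT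
    have hT' : (T : ℝ) ≠ 0 := (NNReal.coe_pos.mpr hT).ne'
    rw [Function.comp_apply, ← EReal.coe_div, add_div, mul_div_cancel_left₀ Λ hT']
  refine tendsto_of_tendsto_of_tendsto_of_le_of_le (hlim (-C)) (hlim C)
    (fun T => ?_) fun T => EReal.div_le_div_right_of_nonneg (mod_cast T.coe_nonneg) (hge T)
  exact EReal.div_le_div_right_of_nonneg (mod_cast T.coe_nonneg) (hle T)

section

variable [Fintype S] [DecidableEq S] {D : Matrix S S ℝ} {x : S}
  {p0 p : ∀ T : ℝ≥0, Measure (CadlagPath S T)}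

lemma hasAverageWelfare_twisted (hD : IsMetzler D) (hp0 : ∀ T, IsMarkovLaw D x T (p0 T))
    (hv : ∀ y, 0 < v y) (hDv : (D + Matrix.diagonal U) *ᵥ v = Λ • v)
    (hp : ∀ T, IsMarkovLaw (twistedGenerator D U Λ v) x T (p T)) : HasAverageWelfare U p0 p Λ :=
  hasAverageWelfare_of_le_of_le (fun T => (hp0 T).le_welfare_twisted hD hv hDv (hp T)) fun T => by
    have := (hp T).isProbabilityMeasure
    exact (hp0 T).welfare_le hD hv hDv

lemma hasAverageWelfare_of_isWelfareOptimal (hD : IsMetzler D)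
    (hp0 : ∀ T, IsMarkovLaw D x T (p0 T)) (hv : ∀ y, 0 < v y)
    (hDv : (D + Matrix.diagonal U) *ᵥ v = Λ • v) (hp : ∀ T, IsWelfareOptimal U (p0 T) (p T)) :
    HasAverageWelfare U p0 p Λ := by
  refine hasAverageWelfare_of_le_of_le (C := ‖fun a : S × S => Real.log (v a.1 / v a.2)‖)
    (fun T => ?_) fun T => ?_
  · have htwist := (hp0 T).tilted_twistLogDensity hD hv hDv
    exact ((hp0 T).le_welfare_twisted hD hv hDv htwist).trans
      ((hp T).2 _ htwist.isProbabilityMeasure)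
  · have := (hp T).1
    exact (hp0 T).welfare_le hD hv hDv

end

end Welfare

theorem mainTheorem4 {S : Type*} [Fintype S] [DecidableEq S]
    (D : Matrix S S ℝ) (hD : IsRateMatrix D) (hirr : IsIrreducibleRate D)
    (U : S → ℝ) (x : S)
    (p0 : ∀ T : ℝ≥0, Measure (CadlagPath S T)) (hp0 : ∀ T, IsMarkovLaw D x T (p0 T))
    (Λ : ℝ) (hΛ : Λ = maxRealPart (D + Matrix.diagonal U)) :
    -- `Λ` is an eigenvalue of `D + I_U`, of maximal real part, with a positive eigenvector
    ((Λ : ℂ) ∈ spectrum ℂ ((D + Matrix.diagonal U).map (algebraMap ℝ ℂ)) ∧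
      (∀ μ ∈ spectrum ℂ ((D + Matrix.diagonal U).map (algebraMap ℝ ℂ)), μ.re ≤ Λ) ∧
      ∃ v : S → ℝ, (∀ y, 0 < v y) ∧ (D + Matrix.diagonal U) *ᵥ v = Λ • v) ∧
    -- (i) finite-horizon maximizers exist, and the limit of their average welfare is `Λ`
    ((∀ T, ∃ p, IsWelfareOptimal U (p0 T) p) ∧
      ∀ pstar : ∀ T : ℝ≥0, Measure (CadlagPath S T),
        (∀ T, IsWelfareOptimal U (p0 T) (pstar T)) → HasAverageWelfare U p0 pstar Λ) ∧
    ∀ v : S → ℝ, (∀ y, 0 < v y) → (D + Matrix.diagonal U) *ᵥ v = Λ • v →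
      -- (ii) the twisted matrix generates a Markov process, which attains the optimal average
      IsRateMatrix (twistedGenerator D U Λ v) ∧
      (∀ T, ∃! p, IsMarkovLaw (twistedGenerator D U Λ v) x T p) ∧
      ∀ pcheck : ∀ T : ℝ≥0, Measure (CadlagPath S T),
        (∀ T, IsMarkovLaw (twistedGenerator D U Λ v) x T (pcheck T)) →
          HasAverageWelfare U p0 pcheck Λ ∧
          -- (iii) its welfare on every finite horizon
          ∀ T : ℝ≥0, welfare U (p0 T) (pcheck T) =
            (((T : ℝ) * Λ -
              ∫ ω, Real.log (v (ω (endTime T)) / v (ω (startTime T))) ∂(pcheck T) : ℝ) :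
                EReal) := by
  have hM := hD.isMetzler
  have : Nonempty S := ⟨x⟩
  have hprob := fun T => (hp0 T).isProbabilityMeasure
  obtain ⟨r, u, hu, hDu⟩ := (hM.add_diagonal U).exists_pos_eigenvector (hirr.add_diagonal U)
  obtain rfl : Λ = r := hΛ.trans ((hM.add_diagonal U).maxRealPart_eq_of_pos_eigenvector hu hDu)
  have hu0 : u ≠ 0 := fun h => (hu x).ne' (congrFun h x)
  refine ⟨⟨mem_spectrum_map_of_eigenvector hu0 hDu,
      fun μ hμ => (hM.add_diagonal U).re_le_of_pos_eigenvector hu hDu hμ, u, hu, hDu⟩,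
    ⟨fun T => ⟨_, isWelfareOptimal_tilted_reward U⟩,
      fun pstar hpstar => hasAverageWelfare_of_isWelfareOptimal hM hp0 hu hDu hpstar⟩,
    fun v hv hDv => ⟨isRateMatrix_twistedGenerator hM hv hDv, fun T => ?_, fun pcheck hpcheck =>
      ⟨hasAverageWelfare_twisted hM hp0 hv hDv hpcheck,
        fun T => (hp0 T).welfare_twisted hM hv hDv (hpcheck T)⟩⟩⟩
  have htwist := (hp0 T).tilted_twistLogDensity hM hv hDv
  exact ⟨_, htwist, fun q hq => hq.unique htwist⟩
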